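/- **Setting.** A finite graph is a compact connected set $G$ containing a finite set $V$ such that each connected component of $G\setminus V$ is homeomorphic to an open interval. A lifted graph is a connected Hausdorff space $T$ with an embedding $h\colon\mathbb R\to T$ (we identify $h(\mathbb R)$ with $\mathbb R$) and a homeomorphism $\tau\colon T\to T$ such that (1) $\tau(h(x))=h(x+1)$ for all $x\in\mathbb R$; (2) the closure of each connected component of $T\setminus\mathbb R$ is a finite graph meeting $\mathbb R$ at exactly one point; (3) only finitely many components $C$ of $T\setminus \mathbb R$ satisfy $\overline C\cap[0,1]\ne\emptyset$; (4) the retraction $r\colon T\to\mathbb R$, which is the identity on $\mathbb R$ and sends each component $C$ of $T\setminus\mathbb R$ to the point of $\overline C\cap\mathbb R$, is continuous. Write $x+k=\tau^k(x)$ for $k\in\mathbb Z$. Let $F\colon T\to T$ be continuous of degree $1$, i.e. $F(x+1)=F(x)+1$. The upper and lower rotation numbers $\overline\rho(x)$, $\underline\rho(x)$ are the $\limsup$ and $\liminf$ of $\frac{r(F^n(x))-r(x)}{n}$ as $n\to+\infty$; if they agree, $\rho(x)$ is the common value. For $S\subset T$ let $\mathrm{Rot}^+_S=\{\overline\rho(x):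 x\in S\}$, $\mathrm{Rot}^-_S=\{\underline\rho(x): x\in S\}$, $\mathrm{Rot}_S=\{\rho(x): x\in S,\ \rho(x)\text{ exists}\}$. A point $x$ is periodic (mod 1) if $F^n(x)\in x+\mathbb Z$ for some $n\ge1$. Put $T_{\mathbb R}=\overline{\bigcup_{n\ge0}F^n(\mathbb R)}$ and $X_F=\overline{T\setminus T_{\mathbb R}}\cap r^{-1}([0,1))$. The map $F$ is $\sigma$-like if $X_F$ is empty or is a compact interval such that $X_F\cap T_{\mathbb R}$ is one of its endpoints; $X_F$ is then ordered so that this endpoint is $\min X_F$. **Proposition.** Let $T$ be a lifted graph and $F\colon T\to T$ a $\sigma$-like map. Let $T'\subset T$ be connected with $T_{\mathbb R}\subset T'$, $T'+1=T'$ and $F(T')\subset T'$. Let $Y=\overline{T\setminus T'}\cap r^{-1}([0,1))$, a compact subinterval of $X_F$, and $Y_\infty=\{x\in Y: F^n(x)\in Y+\mathbb Z\text{ for all }n\ge1\}$. Let $M\ge 1$, let $Y_1,\dots,Y_M$ be nonempty compact subintervals of $Y$ and $q_1,\dots,q_M\in\mathbb Z$ such that - (a) $Y_1<\cdots<Y_M$;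 - (b) $F(Y_i)\subset (Y+q_i)\cup T'$ for $1\le i\le M$; - (c) $F(\min Y_1)=\min Y+q_1$; - (d) $F(Y\setminus(Y_1\cup\cdots\cup Y_M))\cap(Y+\mathbb Z)=\emptyset$. Assume $Y_1\cap Y_\infty\neq\emptyset$. Then there is a compact interval $I\subset\mathbb R$ such that 1. $\mathrm{Rot}_{Y_1\cap Y_\infty}=\mathrm{Rot}^+_{Y_1\cap Y_\infty}=\mathrm{Rot}^-_{Y_1\cap Y_\infty}=I$; 2. $q_1\in I$; 3. there is $a\in Y_1\cap Y_\infty$ with $F(a)=a+q_1$ and $[\min Y_1,a)\cap Y_\infty=\emptyset$; 4. for every rational $\alpha$ in the interior of $I$ there is a periodic (mod 1) point $x\in Y_1\cap Y_\infty$ with $\rho(x)=\alpha$; 5. for every rational $\alpha\in\partial I$ there is a periodic (mod 1) point $x\in\overline{\bigcup_{n\ge0}(F^n(Y_1)+\mathbb Z)}\cap Y_\infty$ with $\rho(x)=\alpha$. -/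

import Mathlib

open Set Filter Topology

/-- A (topological) finite graph in a space: a compact connected set `G` containing a finite set
`V` such that each connected component of `G \ V` is homeomorphic to an open interval. -/
def IsFiniteGraph {T : Type*} [TopologicalSpace T] (G : Set T) : Prop :=
  IsCompact G ∧ IsConnected G ∧
    ∃ V : Set T, V.Finite ∧ V ⊆ G ∧
      ∀ x ∈ G \ V, Nonempty (connectedComponentIn (G \ V) x ≃ₜ Ioo (0 : ℝ) 1)

/-- A line `h : ℝ → T` in `T` together with a homeomorphism `τ` of `T`, the translation by 1. -/
structure LineShift (T : Type*) [TopologicalSpace T] where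
  h : ℝ → T
  τ : T ≃ₜ T

namespace LineShift

variable {T : Type*} [TopologicalSpace T]

/-- The copy of the real line in `T`. -/
def line (L : LineShift T) : Set T := range L.h

/-- The connected component of `x` in the complement of the line (empty for `x` on the line). -/
def comp (L : LineShift T) (x : T) : Set T := connectedComponentIn L.lineᶜ x

open Classical in
/-- The retraction onto the real line: a point `h z` of the line is sent to `z`, and any other
point `x` is sent to the `z` at which the closure of the component of `x` meets the line. -/
noncomputable def retr (L : LineShift T) (x : T) : ℝ :=
  if x ∈ L.line then Classical.epsilon (fun z : ℝ => L.h z = x)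
  else Classical.epsilon (fun z : ℝ => L.h z ∈ closure (L.comp x))

/-- `T`, with the line `h` and the translation `τ`, is a lifted graph. The continuity of the
retraction is part of the notion: it says that `T` has the topology obtained by attaching
the finite graphs to the line. -/
structure IsLiftedGraph (L : LineShift T) : Prop where
  isEmbedding_h : IsEmbedding L.h
  shift_h : ∀ x : ℝ, L.τ (L.h x) = L.h (x + 1)
  finiteGraph_closure_comp : ∀ x ∉ L.line, IsFiniteGraph (closure (L.comp x))
  closure_comp_inter : ∀ x ∉ L.line, ∃ z : ℝ, closure (L.comp x) ∩ L.line = {L.h z}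
  finite_comps : {C : Set T | (∃ x ∉ L.line, C = L.comp x) ∧
    (closure C ∩ L.h '' Icc 0 1).Nonempty}.Finite
  continuous_retr : Continuous L.retr

/-- The translate `x + k`. -/
def translate (L : LineShift T) (k : ℤ) (x : T) : T := (L.τ.toEquiv ^ k : Equiv.Perm T) x

/-- The set `S + ℤ`. -/
def addInt (L : LineShift T) (S : Set T) : Set T := ⋃ k : ℤ, L.translate k '' S

/-- `F` is a continuous map of degree 1. -/
def IsDegreeOne (L : LineShift T) (F : T → T) : Prop :=
  Continuous F ∧ ∀ x, F (L.τ x) = L.τ (F x)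

/-- `x` is periodic (mod 1) for `F`. -/
def IsPeriodicMod (L : LineShift T) (F : T → T) (x : T) : Prop :=
  ∃ n : ℕ, 1 ≤ n ∧ ∃ k : ℤ, F^[n] x = L.translate k x

/-- The mean displacement of `x` after `n` steps. -/
noncomputable def meanDisp (L : LineShift T) (F : T → T) (x : T) (n : ℕ) : ℝ :=
  (L.retr (F^[n] x) - L.retr x) / n

/-- The upper rotation number. The sequence is bounded for a degree 1 map of a lifted graph. -/
noncomputable def upperRot (L : LineShift T) (F : T → T) (x : T) : ℝ :=
  limsup (L.meanDisp F x) atTop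

/-- The lower rotation number. -/
noncomputable def lowerRot (L : LineShift T) (F : T → T) (x : T) : ℝ :=
  liminf (L.meanDisp F x) atTop

/-- The rotation number of `x` exists and is equal to `ρ`. -/
def HasRot (L : LineShift T) (F : T → T) (x : T) (ρ : ℝ) : Prop :=
  Tendsto (L.meanDisp F x) atTop (𝓝 ρ)

/-- The rotation set of `F` on `S`. -/
def Rot (L : LineShift T) (F : T → T) (S : Set T) : Set ℝ := {ρ | ∃ x ∈ S, L.HasRot F x ρ}

/-- The upper rotation set of `F` on `S`. -/
def RotSup (L : LineShift T) (F : T → T) (S : Set T) : Set ℝ := L.upperRot F '' S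

/-- The lower rotation set of `F` on `S`. -/
def RotInf (L : LineShift T) (F : T → T) (S : Set T) : Set ℝ := L.lowerRot F '' S

/-- The closure of the union of the images of the line. -/
def TR (L : LineShift T) (F : T → T) : Set T := closure (⋃ n : ℕ, F^[n] '' L.line)

/-- The part of the closure of the complement of `S` lying over `[0, 1)`. -/
def coreg (L : LineShift T) (S : Set T) : Set T := closure Sᶜ ∩ L.retr ⁻¹' Ico 0 1

/-- The set `X_F`. -/
def XF (L : LineShift T) (F : T → T) : Set T := L.coreg (L.TR F)

/-- `γ` is a homeomorphism of `[0, 1]` onto `X_F`, oriented so that its origin is the only point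
of `X_F` in `T_ℝ`. The order of `X_F` is the one transported by `γ`: it does not depend on the
choice of `γ`. (In a Hausdorff space a continuous injective `γ` is a homeomorphism onto its
range.) -/
structure IsBranch (L : LineShift T) (F : T → T) (γ : unitInterval → T) : Prop where
  continuous : Continuous γ
  injective : Function.Injective γ
  range_eq : range γ = L.XF F
  inter_eq : L.XF F ∩ L.TR F = {γ 0}

/-- `F` is a σ-like map. -/
def IsSigmaLike (L : LineShift T) (F : T → T) : Prop :=
  L.IsDegreeOne F ∧ (L.XF F = ∅ ∨ ∃ γ, L.IsBranch F γ)

/-- The points of `S` all of whose iterates are in `S + ℤ`. -/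
def stay (L : LineShift T) (F : T → T) (S : Set T) : Set T :=
  {x ∈ S | ∀ n : ℕ, 1 ≤ n → F^[n] x ∈ L.addInt S}

/-- The closure of the union over `n ≥ 0` of the sets `F^n(S) + ℤ`. -/
def orbitClosure (L : LineShift T) (F : T → T) (S : Set T) : Set T :=
  closure (⋃ n : ℕ, L.addInt (F^[n] '' S))

end LineShift

/-! Parametrize `X_F` by `[0, 1]`, so that `Y` becomes `[b, 1]`, and follow `F` by the projection,
modulo translations, that collapses everything off the translates of `Y` to `b`. This gives a
continuous interval map `f`. A point with `f x > b` lies in some `Y_i`, and by (b) it is translated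
by `q_i`; by (c), (d) and continuity, `f = b` at the left end of every `Y_i`. A point that stays
keeps its orbit to the right of `min Y_1`, which forces a fixed point of `f` in `Y_1`, and no point
that stays lies below the first one, `a`. So `f` may be replaced by `g = max a f`, and rotation
numbers become Birkhoff averages of a displacement `φ`. What remains is the structure `FoldSystem`:
each `x` with `g x > a` ends an interval of constant displacement whose image contains `[a, g x]`.

Let `[a, t]` be the leftmost interval, with displacement `k = q_1`. Pulling back along an itinerary
(`pull`) turns an orbit segment from `[a, t]` to a point beyond `t` into a loop: a subinterval of
`[a, t]` that covers `[a, t]` with the same total displacement. Inside `[a, t]` the displacement is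
`k`, so an orbit with upper average above `α > k` must leave with average above `α` (`exists_exit`).
Mixing the resulting loop with the one-step loop `[a, t]` gives every rational mean in between
(`exists_isLoop`). A loop contains a periodic point, and infinite concatenations of loops, realized
by compactness, give every real value up to and including the supremum (`exists_tendsto`). Replacing
`φ` by `-φ` treats the values below `k`, and `a` itself has rotation number `k`.

For a rational endpoint `r > k` (`exists_periodic_of_max`), take the least `z` in the closure of the
points reached from `[a, t]` whose sums over `n` steps are all at least `n r`. The excesses over `n
r` are multiples of `1 / r.den`, so one with `n ≥ 1` is minimal; for this `n` the point `g^[n] z`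
has the same property as `z`, so `z ≤ g^[n] z`, and pulling back yields a fixed point of `g^[n]`.
The passage to a limit is the reason why this point is only found in the orbit closure. -/

/-! ### Interval coverings, fixed points and slowly growing sequences -/

/-- Take the last point with value `c`, then the first point after it with value `d`. By the
intermediate value theorem, leaving `[c, d]` in between would produce another such point. -/
theorem exists_Icc_image_eq_of_le {h : ℝ → ℝ} (hh : Continuous h) {x y c d : ℝ} (hxy : x ≤ y)
    (hcd : c ≤ d) (hx : h x = c) (hy : h y = d) :
    ∃ u v, x ≤ u ∧ u ≤ v ∧ v ≤ y ∧ h '' Icc u v = Icc c d := by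
  have hcl : ∀ r, IsClosed {w | h w = r} := fun r => isClosed_eq hh continuous_const
  obtain ⟨u, ⟨⟨hu1, hu2⟩, hu3⟩, hu⟩ : ∃ u, IsGreatest (Icc x y ∩ {w | h w = c}) u :=
    (isCompact_Icc.inter_right (hcl c)).exists_isGreatest ⟨x, ⟨le_rfl, hxy⟩, hx⟩
  obtain ⟨v, ⟨⟨hv1, hv2⟩, hv3⟩, hv⟩ : ∃ v, IsLeast (Icc u y ∩ {w | h w = d}) v :=
    (isCompact_Icc.inter_right (hcl d)).exists_isLeast ⟨y, ⟨hu2, le_rfl⟩, hy⟩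
  rw [mem_ofPred_eq] at hu3 hv3
  refine ⟨u, v, hu1, hv1, hv2, Subset.antisymm ?_ ?_⟩
  · rintro _ ⟨w, ⟨hw1, hw2⟩, rfl⟩
    constructor
    · by_contra hlt
      push Not at hlt
      obtain ⟨p, ⟨hp1, hp2⟩, hp⟩ := intermediate_value_Icc hw2 hh.continuousOn
        (show c ∈ Icc (h w) (h v) from ⟨hlt.le, hv3 ▸ hcd⟩)
      have := hu ⟨⟨hu1.trans (hw1.trans hp1), hp2.trans hv2⟩, hp⟩
      have : w = u := le_antisymm (hp1.trans this) hw1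
      subst this
      linarith
    · by_contra hlt
      push Not at hlt
      obtain ⟨p, ⟨hp1, hp2⟩, hp⟩ := intermediate_value_Icc hw1 hh.continuousOn
        (show d ∈ Icc (h u) (h w) from ⟨hu3 ▸ hcd, hlt.le⟩)
      have := hv ⟨⟨hp1, hp2.trans (hw2.trans hv2)⟩, hp⟩
      have : w = v := le_antisymm hw2 (this.trans hp2)
      subst this
      linarith
  · have := intermediate_value_Icc hv1 hh.continuousOn
    rwa [hu3, hv3] at this

/-- The image is exactly `[c, d]`, not merely a superset: every point of a pulled-back interval then
follows the prescribed itinerary and has the prescribed displacement. -/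
theorem exists_Icc_image_eq {h : ℝ → ℝ} (hh : Continuous h) {u v c d : ℝ} (hcd : c ≤ d)
    (hsub : Icc c d ⊆ h '' Icc u v) :
    ∃ u' v', u ≤ u' ∧ u' ≤ v' ∧ v' ≤ v ∧ h '' Icc u' v' = Icc c d := by
  obtain ⟨x, ⟨hx1, hx2⟩, hx⟩ := hsub ⟨le_rfl, hcd⟩
  obtain ⟨y, ⟨hy1, hy2⟩, hy⟩ := hsub ⟨hcd, le_rfl⟩
  rcases le_total x y with hxy | hxy
  · obtain ⟨u', v', h1, h2, h3, h4⟩ := exists_Icc_image_eq_of_le hh hxy hcd hx hy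
    exact ⟨u', v', hx1.trans h1, h2, h3.trans hy2, h4⟩
  · obtain ⟨u', v', h1, h2, h3, h4⟩ := exists_Icc_image_eq_of_le hh.neg hxy (neg_le_neg hcd)
      (congrArg Neg.neg hy) (congrArg Neg.neg hx)
    refine ⟨u', v', hy1.trans h1, h2, h3.trans hx2, ?_⟩
    have : h '' Icc u' v' = Neg.neg '' ((fun w => -h w) '' Icc u' v') := by
      rw [image_image]; simp
    rw [this, show (fun w => -h w) '' Icc u' v' = Icc (-d) (-c) from h4]
    simp

theorem exists_fixed_of_Icc_subset_image {h : ℝ → ℝ} (hh : Continuous h) {u v : ℝ} (huv : u ≤ v)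
    (hsub : Icc u v ⊆ h '' Icc u v) : ∃ p ∈ Icc u v, h p = p := by
  obtain ⟨x, hx, hx'⟩ := hsub ⟨le_rfl, huv⟩
  obtain ⟨y, hy, hy'⟩ := hsub ⟨huv, le_rfl⟩
  obtain ⟨p, hp, hp'⟩ := isPreconnected_Icc.intermediate_value hx hy
    (hh.sub continuous_id).continuousOn
    (show (0 : ℝ) ∈ Icc (h x - x) (h y - y) from
      ⟨by rw [hx']; linarith [hx.1], by rw [hy']; linarith [hy.2]⟩)
  exact ⟨p, hp, sub_eq_zero.mp hp'⟩

/-- A sequence with bounded increments is `o(n)` if it grows slowly along a sequence of times whose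
gaps are small compared with the times. -/
theorem tendsto_div_zero_of_slow_times {D : ℕ → ℝ} {N : ℕ → ℕ} {C : ℝ} (hC : 0 ≤ C)
    (hD : ∀ n i, |D (n + i) - D n| ≤ C * i) (hN : StrictMono N)
    (hslow : ∀ ε > 0, ∀ᶠ m in atTop, |D (N (m + 1)) - D (N m)| ≤ ε * (N (m + 1) - N m : ℝ))
    (hgap : ∀ ε > 0, ∀ᶠ m in atTop, (N (m + 1) - N m : ℝ) ≤ ε * N m) :
    Tendsto (fun n => D n / n) atTop (𝓝 0) := by
  rw [Metric.tendsto_atTop]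
  intro ε₀ hε₀
  -- Half of `ε₀` is left for the starting value `K`. In the factor `1 + C`, the `1` pays for the
  -- complete stages and `C` for the unfinished last stage.
  set ε := ε₀ / (2 * (1 + C)) with hε
  have hεpos : 0 < ε := by positivity
  obtain ⟨m₀, hm₀⟩ := eventually_atTop.mp ((hslow ε hεpos).and (hgap ε hεpos))
  have hstage : ∀ m ≥ m₀, |D (N m)| ≤ |D (N m₀)| + ε * N m := by
    intro m hm
    induction m, hm using Nat.le_induction with
    | base => have : 0 ≤ ε * N m₀ := by positivity
              linarith
    | succ m hm ih =>
      have h1 := (hm₀ m hm).1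
      have h2 : |D (N (m + 1))| ≤ |D (N (m + 1)) - D (N m)| + |D (N m)| := by
        simpa using abs_add_le (D (N (m + 1)) - D (N m)) (D (N m))
      linarith
  set K := |D (N m₀)| with hK
  obtain ⟨n₁, hn₁⟩ := exists_nat_gt (2 * K / ε₀)
  refine ⟨max (N m₀) (n₁ + 1), fun n hn => ?_⟩
  have hnN : N m₀ ≤ n := (le_max_left _ _).trans hn
  have hn1 : n₁ + 1 ≤ n := (le_max_right _ _).trans hn
  have hnpos : (0 : ℝ) < n := by exact_mod_cast (by omega : 0 < n)
  have hbig : K < ε₀ / 2 * n := by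
    have : (n₁ : ℝ) ≤ n := by exact_mod_cast (by omega : n₁ ≤ n)
    have := hn₁.trans_le this
    rw [div_lt_iff₀ hε₀] at this
    linarith
  obtain ⟨m, hm, hm1, hm2⟩ : ∃ m ≥ m₀, N m ≤ n ∧ n < N (m + 1) := by
    have hex : ∃ m, n < N (m + 1) :=
      ⟨n, lt_of_lt_of_le (Nat.lt_succ_self n) (hN.id_le _)⟩
    classical
    refine ⟨Nat.find hex, ?_, ?_, Nat.find_spec hex⟩
    · by_contra hlt
      push Not at hlt
      have := hN.monotone (Nat.succ_le_of_lt hlt)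
      have h3 := Nat.find_spec hex
      simp only [Nat.succ_eq_add_one] at this
      omega
    · by_cases h0 : Nat.find hex = 0
      · rw [h0]; exact (hN.monotone (Nat.zero_le _)).trans hnN
      · have := Nat.find_min hex (Nat.pred_lt h0)
        rw [Nat.pred_eq_sub_one, Nat.sub_add_cancel (Nat.pos_of_ne_zero h0)] at this
        omega
  have h1 := hstage m hm
  have h2 := (hm₀ m hm).2
  obtain ⟨i, rfl⟩ := Nat.exists_eq_add_of_le hm1
  have h3 := hD (N m) i
  have h4 : |D (N m + i)| ≤ |D (N m + i) - D (N m)| + |D (N m)| := by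
    simpa using abs_add_le (D (N m + i) - D (N m)) (D (N m))
  have h5 : (i : ℝ) ≤ N (m + 1) - N m := by
    have : (N m : ℝ) + i ≤ N (m + 1) := by exact_mod_cast hm2.le
    linarith
  have h6 : C * i ≤ C * (ε * N m) := mul_le_mul_of_nonneg_left (h5.trans h2) hC
  have h7 : ε * (1 + C) = ε₀ / 2 := by rw [hε]; field_simp
  have h8 : (N m : ℝ) ≤ ((N m + i : ℕ) : ℝ) := by push_cast; linarith [Nat.cast_nonneg (α := ℝ) i]
  have h9 : ε₀ / 2 * N m ≤ ε₀ / 2 * ((N m + i : ℕ) : ℝ) :=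
    mul_le_mul_of_nonneg_left h8 (by linarith)
  rw [Real.dist_eq, sub_zero, abs_div, abs_of_pos hnpos, div_lt_iff₀ hnpos]
  have h10 : |D (N m + i)| ≤ K + (ε * (1 + C)) * N m := by linarith
  rw [h7] at h10
  linarith

/-! ### Folding maps of an interval and their loops -/

/-- A continuous map `g` of `[a, e]` fixing `a`, with a displacement `φ`: every point that is not
mapped to `a` is the right end of an interval on which `φ` is a constant integer and whose left
end is mapped to `a`. On the leftmost interval `[a, t]` the displacement is `k`. -/
structure FoldSystem (a t e : ℝ) (g φ : ℝ → ℝ) (k : ℤ) : Prop where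
  continuous_map : Continuous g
  continuous_disp : Continuous φ
  le_left : a ≤ t
  le_right : t ≤ e
  fix : g a = a
  maps : ∀ x, g x ∈ Icc a e
  base : ∀ y ∈ Icc a t, φ y = k
  fold : ∀ x ∈ Icc a e, a < g x → ∃ s ∈ Icc a x, g s = a ∧ ∃ l : ℤ, ∀ y ∈ Icc s x, φ y = l

namespace FoldSystem

variable {a t e : ℝ} {g φ : ℝ → ℝ} {k : ℤ}

theorem neg (H : FoldSystem a t e g φ k) : FoldSystem a t e g (fun x => -φ x) (-k) where
  __ := H
  continuous_disp := H.continuous_disp.neg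
  base y hy := by rw [H.base y hy]; push_cast; rfl
  fold x hx hgx := by
    obtain ⟨s, hs, hgs, l, hl⟩ := H.fold x hx hgx
    exact ⟨s, hs, hgs, -l, fun y hy => by rw [hl y hy]; push_cast; rfl⟩

theorem iterate_mem (H : FoldSystem a t e g φ k) {x : ℝ} (hx : x ∈ Icc a e) (n : ℕ) :
    g^[n] x ∈ Icc a e := by
  cases n with
  | zero => exact hx
  | succ n => rw [Function.iterate_succ_apply']; exact H.maps _

theorem iterate_fix (H : FoldSystem a t e g φ k) (n : ℕ) : g^[n] a = a :=
  Function.iterate_fixed H.fix n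

theorem left_mem (H : FoldSystem a t e g φ k) : a ∈ Icc a t := ⟨le_rfl, H.le_left⟩

theorem Icc_subset (H : FoldSystem a t e g φ k) : Icc a t ⊆ Icc a e :=
  Icc_subset_Icc_right H.le_right

theorem continuous_iterate (H : FoldSystem a t e g φ k) (n : ℕ) : Continuous g^[n] :=
  H.continuous_map.iterate n

theorem continuous_birkhoffSum (H : FoldSystem a t e g φ k) (n : ℕ) :
    Continuous (birkhoffSum g φ n) :=
  continuous_finsetSum _ fun i _ => H.continuous_disp.comp (H.continuous_iterate i)

theorem birkhoffSum_fix (H : FoldSystem a t e g φ k) (n : ℕ) : birkhoffSum g φ n a = n * k := by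
  simp [birkhoffSum, H.iterate_fix, H.base a H.left_mem]

theorem iterate_add_eq_of_eq (H : FoldSystem a t e g φ k) {x : ℝ} {n : ℕ} (hn : g^[n] x = a)
    (m : ℕ) : g^[n + m] x = a := by
  rw [add_comm, Function.iterate_add_apply, hn, H.iterate_fix]

theorem exists_bound (H : FoldSystem a t e g φ k) : ∃ C ≥ 0, ∀ x ∈ Icc a e, |φ x| ≤ C := by
  obtain ⟨C, hC⟩ := isCompact_Icc.exists_bound_of_continuousOn (s := Icc a e)
    H.continuous_disp.continuousOn
  exact ⟨max C 0, le_max_right _ _, fun x hx => (hC x hx).trans (le_max_left _ _)⟩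

theorem abs_birkhoffSum_le (H : FoldSystem a t e g φ k) {C : ℝ}
    (hC : ∀ x ∈ Icc a e, |φ x| ≤ C) {x : ℝ} (hx : x ∈ Icc a e) (n : ℕ) :
    |birkhoffSum g φ n x| ≤ C * n := by
  refine (Finset.abs_sum_le_sum_abs _ _).trans ?_
  refine (Finset.sum_le_card_nsmul _ _ C fun i _ => hC _ (H.iterate_mem hx i)).trans ?_
  simp [mul_comm]

/-- The points whose orbit never reaches `a`. -/
def free (a : ℝ) (g : ℝ → ℝ) : Set ℝ := {x | ∀ n : ℕ, a < g^[n] x}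

theorem free_iterate {x : ℝ} (hx : x ∈ free a g) (n : ℕ) : g^[n] x ∈ free a g := fun m => by
  rw [← Function.iterate_add_apply]; exact hx _

theorem exists_int (H : FoldSystem a t e g φ k) {x : ℝ} (hx : x ∈ Icc a e) (hgx : a < g x) :
    ∃ l : ℤ, φ x = l := by
  obtain ⟨s, hs, -, l, hl⟩ := H.fold x hx hgx
  exact ⟨l, hl x ⟨hs.2, le_rfl⟩⟩

theorem exists_int_birkhoffSum (H : FoldSystem a t e g φ k) {x : ℝ} (hx : x ∈ Icc a e)
    (hf : x ∈ free a g) (n : ℕ) : ∃ l : ℤ, birkhoffSum g φ n x = l := by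
  induction n with
  | zero => exact ⟨0, by simp⟩
  | succ n ih =>
    obtain ⟨l, hl⟩ := ih
    obtain ⟨m, hm⟩ := H.exists_int (H.iterate_mem hx n)
      (by simpa only [Function.iterate_succ_apply'] using hf (n + 1))
    exact ⟨l + m, by rw [birkhoffSum_succ, hl, hm]; push_cast; rfl⟩

/-- Pulling back the interval below the end of an orbit segment along its itinerary. -/
theorem pull (H : FoldSystem a t e g φ k) {n : ℕ} (hn : 1 ≤ n) :
    ∀ x ∈ Icc a e, (∀ i, 1 ≤ i → i ≤ n → a < g^[i] x) →
      ∃ u v, a ≤ u ∧ u ≤ v ∧ v ≤ x ∧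
        (∀ y ∈ Icc u v, birkhoffSum g φ n y = birkhoffSum g φ n x) ∧
        Icc a (g^[n] x) ⊆ g^[n] '' Icc u v := by
  induction n, hn using Nat.le_induction with
  | base =>
    intro x hx h
    obtain ⟨s, hs, hgs, l, hl⟩ := H.fold x hx (h 1 le_rfl le_rfl)
    refine ⟨s, x, hs.1, hs.2, le_rfl, fun y hy => ?_, ?_⟩
    · simp [hl y hy, hl x ⟨hs.2, le_rfl⟩]
    · have := intermediate_value_Icc hs.2 H.continuous_map.continuousOn
      rwa [hgs] at this
  | succ n hn ih =>
    intro x hx h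
    obtain ⟨s, hs, hgs, l, hl⟩ := H.fold x hx (h 1 le_rfl (by omega))
    obtain ⟨u, v, h1, h2, h3, h4, h5⟩ := ih (g x) (H.maps x) fun i hi hin => by
      rw [← Function.iterate_succ_apply]; exact h _ (by omega) (by omega)
    have hcov : Icc u v ⊆ g '' Icc s x := by
      have := intermediate_value_Icc hs.2 H.continuous_map.continuousOn
      rw [hgs] at this
      exact (Icc_subset_Icc h1 h3).trans this
    obtain ⟨u', v', h1', h2', h3', h4'⟩ := exists_Icc_image_eq H.continuous_map h2 hcov
    refine ⟨u', v', hs.1.trans h1', h2', h3', fun y hy => ?_, ?_⟩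
    · have hgy : g y ∈ Icc u v := h4' ▸ mem_image_of_mem g hy
      rw [birkhoffSum_succ', birkhoffSum_succ', h4 _ hgy, hl y ⟨h1'.trans hy.1, hy.2.trans h3'⟩,
        hl x ⟨hs.2, le_rfl⟩]
    · rw [Function.iterate_succ, image_comp, h4']
      exact h5

/-- A subinterval of `[a, t]` that covers `[a, t]` in `n` steps with total displacement `S`. -/
structure IsLoop (a t : ℝ) (g φ : ℝ → ℝ) (n : ℕ) (S u v : ℝ) : Prop where
  pos : 1 ≤ n
  left : a ≤ u
  le : u ≤ v
  right : v ≤ t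
  sum_eq : ∀ y ∈ Icc u v, birkhoffSum g φ n y = S
  cover : Icc a t ⊆ g^[n] '' Icc u v

theorem IsLoop.subset {n : ℕ} {S u v : ℝ} (h : IsLoop a t g φ n S u v) : Icc u v ⊆ Icc a t :=
  Icc_subset_Icc h.left h.right

/-- A loop containing `a` would have the total displacement `n * k` of this fixed point. -/
theorem IsLoop.lt (H : FoldSystem a t e g φ k) {n : ℕ} {S u v : ℝ}
    (h : IsLoop a t g φ n S u v) (hS : S ≠ n * k) : a < u := by
  refine lt_of_le_of_ne h.left fun hau => hS ?_
  rw [← H.birkhoffSum_fix, ← h.sum_eq a ⟨hau.ge, hau ▸ h.le⟩]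

theorem IsLoop.append (H : FoldSystem a t e g φ k) {n n' : ℕ} {S S' u v u' v' : ℝ}
    (h : IsLoop a t g φ n S u v) (h' : IsLoop a t g φ n' S' u' v') :
    ∃ u'' v'', IsLoop a t g φ (n + n') (S + S') u'' v'' := by
  obtain ⟨p, w, h1, h2, h3, h4⟩ := exists_Icc_image_eq (H.continuous_iterate n) h'.le
    (h'.subset.trans h.cover)
  refine ⟨p, w, by have := h.pos; omega, h.left.trans h1, h2, h3.trans h.right, fun y hy => ?_, ?_⟩
  · rw [birkhoffSum_add, h.sum_eq y ⟨h1.trans hy.1, hy.2.trans h3⟩,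
      h'.sum_eq _ (h4 ▸ mem_image_of_mem _ hy)]
  · rw [add_comm, Function.iterate_add, image_comp, h4]
    exact h'.cover

theorem IsLoop.iterate (H : FoldSystem a t e g φ k) {n : ℕ} {S u v : ℝ}
    (h : IsLoop a t g φ n S u v) {p : ℕ} (hp : 1 ≤ p) :
    ∃ u' v', IsLoop a t g φ (p * n) (p * S) u' v' := by
  induction p, hp using Nat.le_induction with
  | base => exact ⟨u, v, by simpa using h⟩
  | succ p hp ih =>
    obtain ⟨u', v', h'⟩ := ih
    obtain ⟨u'', v'', h''⟩ := h'.append H h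
    refine ⟨u'', v'', ?_⟩
    convert h'' using 1
    · ring
    · push_cast; ring

/-- An orbit that reaches `a` remains there, so a periodic one starts at `a`. -/
theorem mem_free_of_periodic (H : FoldSystem a t e g φ k) {p : ℝ} (hp : p ∈ Icc a e) {n : ℕ}
    (hn : 1 ≤ n) (hfix : g^[n] p = p) (hpa : p ≠ a) : p ∈ free a g := by
  intro m
  refine lt_of_le_of_ne (H.iterate_mem hp m).1 fun hm => hpa ?_
  have h1 : g^[n * m] p = p := by
    rw [Function.iterate_mul]; exact Function.iterate_fixed hfix m
  obtain ⟨j, hj⟩ := Nat.exists_eq_add_of_le (Nat.le_mul_of_pos_left m hn)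
  rw [← h1, hj]
  exact H.iterate_add_eq_of_eq hm.symm j

theorem IsLoop.exists_periodic (H : FoldSystem a t e g φ k) {n : ℕ} {S u v : ℝ}
    (h : IsLoop a t g φ n S u v) (hS : S ≠ n * k) :
    ∃ p ∈ Icc a t ∩ free a g, g^[n] p = p ∧ birkhoffSum g φ n p = S := by
  obtain ⟨p, hp, hfix⟩ := exists_fixed_of_Icc_subset_image (H.continuous_iterate n) h.le
    (h.subset.trans h.cover)
  have hpt := h.subset hp
  exact ⟨p, ⟨hpt, H.mem_free_of_periodic (H.Icc_subset hpt) h.pos hfix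
    ((h.lt H hS).trans_le hp.1).ne'⟩, hfix, h.sum_eq p hp⟩

theorem tendsto_of_periodic (H : FoldSystem a t e g φ k) {n : ℕ} {p α : ℝ} (hn : 1 ≤ n)
    (hp : p ∈ Icc a e) (hfix : g^[n] p = p) (hS : birkhoffSum g φ n p = n * α) :
    Tendsto (fun m : ℕ => birkhoffSum g φ m p / m) atTop (𝓝 α) := by
  obtain ⟨C, hC0, hC⟩ := H.exists_bound
  have hmul : ∀ j : ℕ, birkhoffSum g φ (j * n) p = (j * n : ℕ) * α := by
    intro j
    induction j with
    | zero => simp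
    | succ j ih =>
      rw [Nat.succ_mul, birkhoffSum_add, ih, mul_comm j n, Function.iterate_mul,
        Function.iterate_fixed hfix j, hS]
      push_cast; ring
  have hbd : ∀ m : ℕ, |birkhoffSum g φ m p - m * α| ≤ (C + |α|) * n := by
    intro m
    have h1 := hmul (m / n)
    have h2 : birkhoffSum g φ m p
        = birkhoffSum g φ (m / n * n) p + birkhoffSum g φ (m % n) (g^[m / n * n] p) := by
      rw [← birkhoffSum_add, Nat.div_add_mod']
    have h3 : (m : ℝ) = (m / n * n : ℕ) + (m % n : ℕ) := by
      exact_mod_cast (Nat.div_add_mod' m n).symm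
    have h4 := H.abs_birkhoffSum_le hC (H.iterate_mem hp (m / n * n)) (m % n)
    have h5 : ((m % n : ℕ) : ℝ) ≤ n := by exact_mod_cast (Nat.mod_lt m hn).le
    rw [h2, h1, h3]
    calc _ = |birkhoffSum g φ (m % n) (g^[m / n * n] p) - (m % n : ℕ) * α| := by ring_nf
      _ ≤ C * (m % n : ℕ) + (m % n : ℕ) * |α| := by
        refine (abs_sub _ _).trans (add_le_add h4 ?_)
        rw [abs_mul, Nat.abs_cast]
      _ = (C + |α|) * (m % n : ℕ) := by ring
      _ ≤ _ := mul_le_mul_of_nonneg_left h5 (by positivity)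
  have hlim : Tendsto (fun m : ℕ => (birkhoffSum g φ m p - m * α) / m) atTop (𝓝 0) := by
    refine squeeze_zero_norm (fun m => ?_)
      (tendsto_const_div_atTop_nhds_zero_nat ((C + |α|) * n))
    rw [norm_div, Real.norm_eq_abs, Real.norm_natCast]
    exact div_le_div_of_nonneg_right (hbd m) (Nat.cast_nonneg m)
  have := hlim.add_const α
  rw [zero_add] at this
  refine this.congr' ?_
  filter_upwards [eventually_ge_atTop 1] with m hm
  have : (m : ℝ) ≠ 0 := by positivity
  field_simp
  ring

end FoldSystem

/-! ### Rotation numbers realized by concatenated loops -/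

namespace FoldSystem

variable {a t e : ℝ} {g φ : ℝ → ℝ} {k : ℤ}

/-- A point of the leftmost interval whose displacement is frequently at least `β` on average
leaves this interval with a larger total displacement than `α` on average, for each `α < β`. -/
theorem exists_exit (H : FoldSystem a t e g φ k) {x α β : ℝ} (hx : x ∈ Icc a t) (hkα : k < α)
    (hαβ : α < β) (hfreq : ∃ᶠ n : ℕ in atTop, β ≤ birkhoffSum g φ n x / n) :
    ∃ m, 1 ≤ m ∧ t < g^[m] x ∧ m * α < birkhoffSum g φ m x := by
  by_contra! hcon
  obtain ⟨C, hC0, hC⟩ := H.exists_bound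
  have hxe := H.Icc_subset hx
  -- In `[a, t]` each step adds `k < α`. Beyond `t` the sum is at most `n * α` by assumption, so the
  -- next step overshoots by at most `C + |α|`.
  have hbd : ∀ n : ℕ, birkhoffSum g φ n x ≤ n * α + (C + |α|) := by
    intro n
    induction n with
    | zero => simp; positivity
    | succ n ih =>
      rw [birkhoffSum_succ]
      push_cast
      rcases le_or_gt (g^[n] x) t with h | h
      · rw [H.base _ ⟨(H.iterate_mem hxe n).1, h⟩]
        linarith
      · have hn : 1 ≤ n := by
          rcases Nat.eq_zero_or_pos n with rfl | h0
          · exact absurd h (not_lt.mpr hx.2)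
          · exact h0
        have h1 := hcon n hn h
        have h2 := (abs_le.mp (hC _ (H.iterate_mem hxe n))).2
        have h3 := neg_abs_le α
        linarith
  obtain ⟨n₀, hn₀⟩ := exists_nat_gt ((C + |α|) / (β - α))
  obtain ⟨n, hn, hn'⟩ := (hfreq.and_eventually (eventually_ge_atTop (n₀ + 1))).exists
  have hnpos : (0 : ℝ) < n := by exact_mod_cast (by omega : 0 < n)
  rw [le_div_iff₀ hnpos] at hn
  have h1 := hbd n
  have h2 : (n₀ : ℝ) ≤ n := by exact_mod_cast (by omega : n₀ ≤ n)
  have h3 := hn₀.trans_le h2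
  rw [div_lt_iff₀ (by linarith)] at h3
  linarith

theorem exists_map_gt (H : FoldSystem a t e g φ k) {x : ℝ} (hx : x ∈ Icc a t)
    (hm : ∃ m, t < g^[m] x) : ∃ y ∈ Icc a t, t < g y := by
  classical
  have h0 : Nat.find hm ≠ 0 := fun h => by
    have := Nat.find_spec hm
    rw [h] at this
    exact absurd this (not_lt.mpr hx.2)
  refine ⟨g^[Nat.find hm - 1] x, ⟨(H.iterate_mem (H.Icc_subset hx) _).1,
    not_lt.mp (Nat.find_min hm (by omega))⟩, ?_⟩
  have := Nat.find_spec hm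
  rwa [← Nat.sub_add_cancel (Nat.pos_of_ne_zero h0), Function.iterate_succ_apply'] at this

theorem isLoop_base (H : FoldSystem a t e g φ k) (hex : ∃ y ∈ Icc a t, t < g y) :
    IsLoop a t g φ 1 k a t where
  pos := le_rfl
  left := le_rfl
  le := H.le_left
  right := le_rfl
  sum_eq y hy := by simp [H.base y hy]
  cover := by
    obtain ⟨y, hy, hgy⟩ := hex
    have := intermediate_value_Icc hy.1 H.continuous_map.continuousOn
    rw [H.fix] at this
    exact (Icc_subset_Icc_right hgy.le).trans
      (this.trans (image_mono (Icc_subset_Icc_right hy.2)))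

/-- Every rational strictly between the base displacement and an upper rotation number is the
mean displacement of a loop. -/
theorem exists_isLoop (H : FoldSystem a t e g φ k) {x β : ℝ} (hx : x ∈ Icc a t ∩ free a g)
    (hfreq : ∃ᶠ n : ℕ in atTop, β ≤ birkhoffSum g φ n x / n) {r : ℚ} (hkr : (k : ℝ) < r)
    (hrβ : (r : ℝ) < β) : ∃ n u v, IsLoop a t g φ n (n * r) u v := by
  obtain ⟨m, hm, hgm, hBm⟩ := H.exists_exit hx.1 hkr hrβ hfreq
  have hxe := H.Icc_subset hx.1
  obtain ⟨u, v, h1, h2, h3, h4, h5⟩ := H.pull hm x hxe fun i _ _ => hx.2 i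
  have hloop : IsLoop a t g φ m (birkhoffSum g φ m x) u v :=
    ⟨hm, h1, h2, h3.trans hx.1.2, h4, (Icc_subset_Icc_right hgm.le).trans h5⟩
  have hbase := H.isLoop_base (H.exists_map_gt hx.1 ⟨m, hgm⟩)
  obtain ⟨l, hl⟩ := H.exists_int_birkhoffSum hxe hx.2 m
  have hden : (0 : ℝ) < r.den := by exact_mod_cast r.pos
  have hr : (r : ℝ) * r.den = r.num := by exact_mod_cast Rat.mul_den_eq_num r
  -- With `B` the displacement of the first loop, `p` copies of it and `j` copies of the base loop
  -- have mean `r` exactly when `p * (B - m * r) = j * (r - k)`. Clearing the denominator of `r`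
  -- leads to integer weights because `B` is an integer.
  obtain ⟨p, hp⟩ : ∃ p : ℕ, (p : ℤ) = r.num - k * r.den := Int.eq_ofNat_of_zero_le (by
    have : (0 : ℝ) ≤ r.num - k * r.den := by rw [← hr]; nlinarith
    exact_mod_cast this) |>.imp fun _ h => h.symm
  obtain ⟨j, hj⟩ : ∃ j : ℕ, (j : ℤ) = l * r.den - m * r.num := Int.eq_ofNat_of_zero_le (by
    have : (0 : ℝ) ≤ l * r.den - m * r.num := by rw [← hr, ← hl]; nlinarith
    exact_mod_cast this) |>.imp fun _ h => h.symm
  have hp' : (p : ℝ) = (r - k) * r.den := by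
    rw [sub_mul, hr]; exact_mod_cast hp
  have hj' : (j : ℝ) = (birkhoffSum g φ m x - m * r) * r.den := by
    rw [hl, sub_mul, mul_assoc, hr]; exact_mod_cast hj
  have hp1 : 1 ≤ p := by
    have : (0 : ℝ) < p := by rw [hp']; exact mul_pos (by linarith) hden
    exact_mod_cast this
  have hj1 : 1 ≤ j := by
    have : (0 : ℝ) < j := by rw [hj']; exact mul_pos (by linarith) hden
    exact_mod_cast this
  obtain ⟨u₁, v₁, hA⟩ := hloop.iterate H hp1
  obtain ⟨u₂, v₂, hB⟩ := hbase.iterate H hj1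
  obtain ⟨u₃, v₃, hAB⟩ := hA.append H hB
  refine ⟨p * m + j * 1, u₃, v₃, ?_⟩
  convert hAB using 1
  push_cast
  rw [hp', hj']
  ring

/-- Infinite concatenations of loops are realized by points. -/
theorem exists_mem_of_isLoop (H : FoldSystem a t e g φ k) {n : ℕ → ℕ} {S u v : ℕ → ℝ}
    (hloop : ∀ m, IsLoop a t g φ (n m) (S m) (u m) (v m)) {N : ℕ → ℕ} (hN0 : N 0 = 0)
    (hN : ∀ m, N (m + 1) = N m + n m) :
    ∃ y ∈ Icc a t, ∀ m, g^[N m] y ∈ Icc (u m) (v m) := by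
  have hclosed : ∀ m, IsClosed {y | g^[N m] y ∈ Icc (u m) (v m)} := fun m =>
    isClosed_Icc.preimage (H.continuous_iterate _)
  let K : ℕ → Set ℝ := fun m => Icc a t ∩ ⋂ i < m, {y | g^[N i] y ∈ Icc (u i) (v i)}
  have hKclosed : ∀ m, IsClosed (K m) := fun m =>
    isClosed_Icc.inter (isClosed_biInter fun i _ => hclosed i)
  -- The first `m` loops can be followed so as to end at any point of `[a, t]`; hence the nested
  -- compact sets `K m` are nonempty.
  have hcover : ∀ m, Icc a t ⊆ g^[N m] '' K m := by
    intro m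
    induction m with
    | zero => simp [K, hN0]
    | succ m ih =>
      intro z hz
      obtain ⟨w, hw, rfl⟩ := (hloop m).cover hz
      obtain ⟨y, ⟨hy1, hy2⟩, rfl⟩ := ih ((hloop m).subset hw)
      refine ⟨y, ⟨hy1, ?_⟩, ?_⟩
      · simp only [mem_iInter] at hy2 ⊢
        intro i hi
        rcases Nat.lt_succ_iff_lt_or_eq.mp hi with h | rfl
        · exact hy2 i h
        · exact hw
      · rw [hN, add_comm, Function.iterate_add_apply]
  obtain ⟨y, hy⟩ := IsCompact.nonempty_iInter_of_sequence_nonempty_isCompact_isClosed K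
    (fun m => inter_subset_inter_right _ (biInter_mono (fun i hi => Nat.lt_succ_of_lt hi)
      fun _ _ => Subset.rfl))
    (fun m => by
      obtain ⟨y, hy, -⟩ := hcover m H.left_mem
      exact ⟨y, hy⟩)
    (isCompact_Icc.inter_right (isClosed_biInter fun i _ => hclosed i)) hKclosed
  rw [mem_iInter] at hy
  refine ⟨y, (hy 0).1, fun m => ?_⟩
  have := (hy (m + 1)).2
  simp only [mem_iInter] at this
  exact this m (Nat.lt_succ_self m)

/-- A limit of mean displacements of loops is a rotation number. -/
theorem exists_tendsto (H : FoldSystem a t e g φ k) {α : ℝ} {n : ℕ → ℕ} {S u v : ℕ → ℝ}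
    (hloop : ∀ j, IsLoop a t g φ (n j) (S j) (u j) (v j)) (hS : ∀ j, S j ≠ n j * k)
    (hα : Tendsto (fun j => S j / n j) atTop (𝓝 α)) :
    ∃ y ∈ Icc a t ∩ free a g, Tendsto (fun m : ℕ => birkhoffSum g φ m y / m) atTop (𝓝 α) := by
  classical
  obtain ⟨C, hC0, hC⟩ := H.exists_bound
  -- `J N` is the index of the loop to use at time `N`. Its length is at most `N / J N` when `J N >
  -- 0`, so the gaps are small compared with the time, while `J N` still tends to infinity.
  let J : ℕ → ℕ := fun N => Nat.findGreatest (fun j => j * n j ≤ N) N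
  have hJ1 : ∀ N, J N * n (J N) ≤ N := fun N =>
    Nat.findGreatest_spec (P := fun j => j * n j ≤ N) (Nat.zero_le N) (by simp)
  have hJ2 : Tendsto J atTop atTop := by
    refine tendsto_atTop.mpr fun j => ?_
    filter_upwards [eventually_ge_atTop (max j (j * n j))] with N hN
    exact Nat.le_findGreatest ((le_max_left _ _).trans hN) ((le_max_right _ _).trans hN)
  let N : ℕ → ℕ := fun m => Nat.rec 0 (fun _ N => N + n (J N)) m
  have hN0 : N 0 = 0 := rfl
  have hN : ∀ m, N (m + 1) = N m + n (J (N m)) := fun m => rfl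
  have hNmono : StrictMono N := strictMono_nat_of_lt_succ fun m => by
    rw [hN]; have := (hloop (J (N m))).pos; omega
  clear_value N J
  obtain ⟨y, hy, hyN⟩ := H.exists_mem_of_isLoop (fun m => hloop (J (N m))) hN0 hN
  have hye := H.Icc_subset hy
  -- After reaching `a` the orbit would remain there, but at each time `N m` it is in a loop, which
  -- begins strictly to the right of `a`.
  have hfree : y ∈ free a g := by
    intro i
    refine lt_of_le_of_ne (H.iterate_mem hye i).1 fun hi => ?_
    obtain ⟨l, hl⟩ := Nat.exists_eq_add_of_le (hNmono.id_le i)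
    have h1 := H.iterate_add_eq_of_eq hi.symm l
    rw [id] at hl
    rw [← hl] at h1
    have h2 := (hyN i).1
    rw [h1] at h2
    exact absurd ((hloop _).lt H (hS _)) (not_lt.mpr h2)
  refine ⟨y, ⟨hy, hfree⟩, ?_⟩
  have hJN : Tendsto (fun m => J (N m)) atTop atTop := hJ2.comp hNmono.tendsto_atTop
  have key : Tendsto (fun m : ℕ => (birkhoffSum g φ m y - m * α) / m) atTop (𝓝 0) := by
    refine tendsto_div_zero_of_slow_times (C := C + |α|) (by positivity) ?_ hNmono ?_ ?_
    · intro m i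
      rw [birkhoffSum_add]
      have h := H.abs_birkhoffSum_le hC (H.iterate_mem hye m) i
      push_cast
      calc _ = |birkhoffSum g φ i (g^[m] y) - i * α| := by ring_nf
        _ ≤ C * i + i * |α| := by
          refine (abs_sub _ _).trans (add_le_add h ?_)
          rw [abs_mul, Nat.abs_cast]
        _ = _ := by ring
    · intro ε hε
      have := (hα.comp hJN).eventually (Metric.closedBall_mem_nhds α hε)
      filter_upwards [this] with m hm
      have hpos : (0 : ℝ) < n (J (N m)) := by exact_mod_cast (hloop (J (N m))).pos
      replace hm : |S (J (N m)) / n (J (N m)) - α| ≤ ε := hm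
      rw [hN, birkhoffSum_add, (hloop _).sum_eq _ (hyN m)]
      push_cast
      calc _ = |(S (J (N m)) / n (J (N m)) - α) * n (J (N m))| := by
            congr 1; field_simp; ring
        _ ≤ ε * n (J (N m)) := by
          rw [abs_mul, Nat.abs_cast]
          exact mul_le_mul_of_nonneg_right hm hpos.le
        _ = _ := by ring
    · intro ε hε
      obtain ⟨i, hi⟩ := exists_nat_gt (1 / ε)
      filter_upwards [hJN.eventually (eventually_ge_atTop i)] with m hm
      rw [hN]
      have h1 : ((J (N m) : ℝ)) * n (J (N m)) ≤ ((N m : ℕ) : ℝ) := by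
        exact_mod_cast hJ1 (N m)
      have h2 : (i : ℝ) ≤ J (N m) := by exact_mod_cast hm
      have h3 : 1 ≤ ε * ((J (N m) : ℕ) : ℝ) := by
        rw [div_lt_iff₀ hε] at hi
        nlinarith
      have h4 : (0 : ℝ) ≤ n (J (N m)) := Nat.cast_nonneg _
      push_cast
      have h5 : (n (J (N m)) : ℝ) ≤ ε * (J (N m) : ℕ) * n (J (N m)) := le_mul_of_one_le_left h4 h3
      have h6 := mul_le_mul_of_nonneg_left h1 hε.le
      linarith
  have := key.add_const α
  rw [zero_add] at this
  refine this.congr' ?_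
  filter_upwards [eventually_ge_atTop 1] with m hm
  have : (m : ℝ) ≠ 0 := by positivity
  field_simp
  ring

end FoldSystem

/-! ### Reached points and the rational ends of the rotation interval -/

namespace FoldSystem

variable {a t e : ℝ} {g φ : ℝ → ℝ} {k : ℤ}

/-- The points reached from the leftmost interval. -/
def reach (a t : ℝ) (g : ℝ → ℝ) : Set ℝ := ⋃ n : ℕ, g^[n] '' Icc a t

theorem subset_reach : Icc a t ⊆ reach a t g := fun x hx => mem_iUnion.mpr ⟨0, x, hx, rfl⟩

theorem map_mem_reach {x : ℝ} (hx : x ∈ reach a t g) : g x ∈ reach a t g := by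
  obtain ⟨n, y, hy, rfl⟩ := mem_iUnion.mp hx
  exact mem_iUnion.mpr ⟨n + 1, y, hy, Function.iterate_succ_apply' _ _ _⟩

theorem reach_subset (H : FoldSystem a t e g φ k) : reach a t g ⊆ Icc a e := by
  refine iUnion_subset fun n => ?_
  rintro _ ⟨y, hy, rfl⟩
  exact H.iterate_mem (H.Icc_subset hy) n

theorem closure_reach_subset (H : FoldSystem a t e g φ k) : closure (reach a t g) ⊆ Icc a e :=
  closure_minimal H.reach_subset isClosed_Icc

theorem mem_reach_of_le (H : FoldSystem a t e g φ k) {x y : ℝ} (hy : y ∈ reach a t g)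
    (hax : a ≤ x) (hxy : x ≤ y) : x ∈ reach a t g := by
  obtain ⟨n, w, hw, rfl⟩ := mem_iUnion.mp hy
  have := intermediate_value_Icc hw.1 (H.continuous_iterate n).continuousOn
  rw [H.iterate_fix] at this
  obtain ⟨v, hv, rfl⟩ := this ⟨hax, hxy⟩
  exact mem_iUnion.mpr ⟨n, v, ⟨hv.1, hv.2.trans hw.2⟩, rfl⟩

theorem mem_reach_of_lt (H : FoldSystem a t e g φ k) {x y : ℝ} (hy : y ∈ closure (reach a t g))
    (hax : a ≤ x) (hxy : x < y) : x ∈ reach a t g := by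
  obtain ⟨w, hxw, hw⟩ := mem_closure_iff.mp hy _ isOpen_Ioi hxy
  exact H.mem_reach_of_le hw hax (le_of_lt hxw)

theorem mem_closure_reach_of_le (H : FoldSystem a t e g φ k) {x y : ℝ}
    (hy : y ∈ closure (reach a t g)) (hax : a ≤ x) (hxy : x ≤ y) : x ∈ closure (reach a t g) := by
  rcases hxy.eq_or_lt with rfl | h
  · exact hy
  · exact subset_closure (H.mem_reach_of_lt hy hax h)

theorem map_mem_closure_reach (H : FoldSystem a t e g φ k) {x : ℝ}
    (hx : x ∈ closure (reach a t g)) : g x ∈ closure (reach a t g) :=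
  map_mem_closure H.continuous_map hx fun _ => map_mem_reach

theorem iterate_mem_closure_reach (H : FoldSystem a t e g φ k) {x : ℝ}
    (hx : x ∈ closure (reach a t g)) (n : ℕ) : g^[n] x ∈ closure (reach a t g) := by
  induction n with
  | zero => exact hx
  | succ n ih => rw [Function.iterate_succ_apply']; exact H.map_mem_closure_reach ih

theorem tendsto_of_tendsto_iterate (H : FoldSystem a t e g φ k) {x α : ℝ} (hx : x ∈ Icc a e)
    (j : ℕ) (h : Tendsto (fun m : ℕ => birkhoffSum g φ m (g^[j] x) / m) atTop (𝓝 α)) :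
    Tendsto (fun m : ℕ => birkhoffSum g φ m x / m) atTop (𝓝 α) := by
  obtain ⟨C, hC0, hC⟩ := H.exists_bound
  have hlim : Tendsto (fun m : ℕ => birkhoffSum g φ m x / m - birkhoffSum g φ m (g^[j] x) / m)
      atTop (𝓝 0) := by
    refine squeeze_zero_norm (fun m => ?_) (tendsto_const_div_atTop_nhds_zero_nat (2 * C * j))
    rw [← sub_div, norm_div, Real.norm_eq_abs, Real.norm_natCast]
    refine div_le_div_of_nonneg_right ?_ (Nat.cast_nonneg m)
    have h1 := birkhoffSum_add g φ j m x
    rw [add_comm j m, birkhoffSum_add] at h1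
    have h2 := H.abs_birkhoffSum_le hC hx j
    have h3 := H.abs_birkhoffSum_le hC (H.iterate_mem hx m) j
    rw [show birkhoffSum g φ m x - birkhoffSum g φ m (g^[j] x)
      = birkhoffSum g φ j x - birkhoffSum g φ j (g^[m] x) by linarith]
    refine (abs_sub _ _).trans ?_
    linarith
  simpa using hlim.add h

/-- If the supremum of the reached points is not reached, there are points below it, arbitrarily
high, that are moved up. -/
theorem exists_lt_map_of_notMem_reach (H : FoldSystem a t e g φ k) {p : ℝ}
    (hp : p ∈ closure (reach a t g)) (hpr : p ∉ reach a t g) {w : ℝ} (hw : w ∈ reach a t g) :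
    ∃ u ∈ reach a t g, w ≤ u ∧ u < g u := by
  by_contra! hcon
  wlog htw : t ≤ w generalizing w
  · exact this (subset_reach ⟨H.le_left, le_rfl⟩)
      (fun u hu htu => hcon u hu ((not_le.mp htw).le.trans htu)) le_rfl
  have haw : a ≤ w := H.le_left.trans htw
  obtain ⟨x₀, hx₀, hmax⟩ := isCompact_Icc.exists_isMaxOn (nonempty_Icc.mpr haw)
    H.continuous_map.continuousOn
  have hβ : max w (g x₀) ∈ reach a t g := by
    rcases max_choice w (g x₀) with h | h <;> rw [h]
    · exact hw
    · exact map_mem_reach (H.mem_reach_of_le hw hx₀.1 hx₀.2)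
  -- If no reached point above `w` moves up, this interval is invariant and traps all reached
  -- points. Its right end is reached, and hence so is `p`, a contradiction.
  have hmaps : MapsTo g (Icc a (max w (g x₀))) (Icc a (max w (g x₀))) := by
    refine fun u hu => ⟨(H.maps u).1, ?_⟩
    rcases le_total u w with h | h
    · exact (hmax ⟨hu.1, h⟩).trans (le_max_right _ _)
    · exact (hcon u (H.mem_reach_of_le hβ hu.1 hu.2) h).trans hu.2
  have hsub : reach a t g ⊆ Icc a (max w (g x₀)) := by
    refine iUnion_subset fun n => ?_
    rintro _ ⟨y, hy, rfl⟩
    exact hmaps.iterate n ⟨hy.1, hy.2.trans (htw.trans (le_max_left _ _))⟩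
  have := closure_minimal hsub isClosed_Icc hp
  exact hpr (H.mem_reach_of_le hβ this.1 this.2)

/-- If no point of the leftmost interval has a rotation number larger than `α ≥ k`, then no
periodic point in the closure of the reached points has one. -/
theorem birkhoffSum_le_of_periodic (H : FoldSystem a t e g φ k) {α : ℝ} (hkα : k ≤ α)
    (hmax : ∀ y ∈ Icc a t ∩ free a g, ∀ ρ,
      Tendsto (fun m : ℕ => birkhoffSum g φ m y / m) atTop (𝓝 ρ) → ρ ≤ α)
    {p : ℝ} (hp : p ∈ closure (reach a t g)) {n : ℕ} (hn : 1 ≤ n) (hfix : g^[n] p = p) :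
    birkhoffSum g φ n p ≤ n * α := by
  have hreach : ∀ p ∈ reach a t g, ∀ n : ℕ, 1 ≤ n → g^[n] p = p →
      birkhoffSum g φ n p ≤ n * α := by
    intro p hp n hn hfix
    have hpe := H.reach_subset hp
    by_cases hpa : p = a
    · rw [hpa, H.birkhoffSum_fix]
      exact mul_le_mul_of_nonneg_left hkα (Nat.cast_nonneg n)
    have hfree := H.mem_free_of_periodic hpe hn hfix hpa
    obtain ⟨j, y, hy, rfl⟩ := mem_iUnion.mp hp
    have hye := H.Icc_subset hy
    have hyfree : y ∈ free a g := fun i => by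
      refine lt_of_le_of_ne (H.iterate_mem hye i).1 fun hi => (hfree i).ne ?_
      rw [← Function.iterate_add_apply, H.iterate_add_eq_of_eq hi.symm]
    have hn0 : (0 : ℝ) < n := by exact_mod_cast hn
    have := H.tendsto_of_periodic (α := birkhoffSum g φ n (g^[j] y) / n) hn hpe hfix
      (by field_simp)
    have := hmax y ⟨hy, hyfree⟩ _ (H.tendsto_of_tendsto_iterate hye j this)
    rwa [div_le_iff₀ hn0, mul_comm] at this
  by_cases hpr : p ∈ reach a t g
  · exact hreach p hpr n hn hfix
  have hpe := H.closure_reach_subset hp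
  have hpa : p ≠ a := fun h => hpr (h.symm ▸ subset_reach H.left_mem)
  have hfree := H.mem_free_of_periodic hpe hn hfix hpa
  obtain ⟨s, hs, hgs, l, hl⟩ := H.fold p hpe (hfree 1)
  have hsp : s < p := lt_of_le_of_ne hs.2 fun h => (hfree 1).ne' (h ▸ hgs)
  have hlt : ∀ u ∈ reach a t g, u < p := fun u hu => by
    by_contra! h
    exact hpr (H.mem_reach_of_le hu hpe.1 h)
  -- Just below `p` the displacement is `l`, and some reached point there moves up. Pulling back one
  -- step gives a reached fixed point with displacement `l`.
  have hlα : (l : ℝ) ≤ α := by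
    obtain ⟨u, hu, hsu, hgu⟩ := H.exists_lt_map_of_notMem_reach hp hpr
      (H.mem_reach_of_lt hp hs.1 hsp)
    have hue := H.reach_subset hu
    obtain ⟨u₁, v₁, h1, h2, h3, h4, h5⟩ := H.pull le_rfl u hue fun i hi hi' => by
      obtain rfl : i = 1 := le_antisymm hi' hi
      exact hue.1.trans_lt hgu
    obtain ⟨p', hp', hfix'⟩ := exists_fixed_of_Icc_subset_image (H.continuous_iterate 1) h2
      ((Icc_subset_Icc h1 (h3.trans hgu.le)).trans h5)
    have := hreach p' (H.mem_reach_of_le hu (h1.trans hp'.1) (hp'.2.trans h3)) 1 le_rfl hfix'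
    rw [h4 p' hp'] at this
    simpa [hl u ⟨hsu, (hlt u hu).le⟩] using this
  -- If `g p > p`, then `p` lies below a limit of reached points and is reached. If `g p < p`, all
  -- points near `p` move down, but reached points arbitrarily close to `p` move up.
  have hgp : g p = p := by
    refine le_antisymm ?_ ?_
    · by_contra! h
      exact hpr (H.mem_reach_of_lt (H.map_mem_closure_reach hp) hpe.1 h)
    · by_contra! h
      have hev : ∀ᶠ u in 𝓝 p, g u < u :=
        H.continuous_map.continuousAt.eventually_lt continuousAt_id h
      obtain ⟨ε, hε, hball⟩ := Metric.eventually_nhds_iff.mp hev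
      obtain ⟨w, hw1, hw⟩ := mem_closure_iff.mp hp _ isOpen_Ioi
        (show p ∈ Ioi (p - ε) from sub_lt_self p hε)
      obtain ⟨u, hu, hwu, hgu⟩ := H.exists_lt_map_of_notMem_reach hp hpr hw
      have := hlt u hu
      refine absurd (hball (y := u) ?_) (not_lt.mpr hgu.le)
      rw [Real.dist_eq, abs_lt]
      constructor <;> linarith [mem_Ioi.mp hw1]
  have : birkhoffSum g φ n p = n * l := by
    simp [birkhoffSum, Function.iterate_fixed hgp, hl p ⟨hs.2, le_rfl⟩]
  rw [this]
  exact mul_le_mul_of_nonneg_left hlα (Nat.cast_nonneg n)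

/-- Start the orbit at the time `j` minimizing the excess over `m * r`, tilted by `δ * m` so that a
minimum exists. From there the excess after `i ≤ N` steps is at least `-δ * i > -1 / r.den`; being a
multiple of `1 / r.den`, it is nonnegative. -/
theorem exists_forall_le_birkhoffSum (H : FoldSystem a t e g φ k) {r : ℚ} {x : ℝ}
    (hx : x ∈ Icc a t ∩ free a g)
    (hxr : Tendsto (fun m : ℕ => birkhoffSum g φ m x / m) atTop (𝓝 (r : ℝ))) (N : ℕ) :
    ∃ z ∈ reach a t g, ∀ i ≤ N, i * (r : ℝ) ≤ birkhoffSum g φ i z := by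
  have hxe := H.Icc_subset hx.1
  have hden : (0 : ℝ) < r.den := by exact_mod_cast r.pos
  have hr : (r : ℝ) * r.den = r.num := by exact_mod_cast Rat.mul_den_eq_num r
  set δ : ℝ := 1 / (r.den * (N + 1)) with hδ
  have hδ0 : 0 < δ := by positivity
  have hlim : Tendsto (fun m : ℕ => birkhoffSum g φ m x - m * r + δ * m) cofinite atTop := by
    rw [Nat.cofinite_eq_atTop]
    have h1 : Tendsto (fun m : ℕ => (birkhoffSum g φ m x / m - r + δ)) atTop (𝓝 (r - r + δ)) :=
      (hxr.sub_const _).add_const _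
    rw [sub_self, zero_add] at h1
    refine (h1.pos_mul_atTop hδ0 tendsto_natCast_atTop_atTop).congr' ?_
    filter_upwards [eventually_ge_atTop 1] with m hm
    have : (m : ℝ) ≠ 0 := by positivity
    field_simp
  obtain ⟨j, hj⟩ := hlim.exists_forall_le
  refine ⟨g^[j] x, mem_iUnion.mpr ⟨j, x, hx.1, rfl⟩, fun i hi => ?_⟩
  obtain ⟨l, hl⟩ := H.exists_int_birkhoffSum (H.iterate_mem hxe j) (free_iterate hx.2 j) i
  have h1 := hj (j + i)
  rw [birkhoffSum_add] at h1
  push_cast at h1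
  have h2 : -(δ * i) ≤ birkhoffSum g φ i (g^[j] x) - i * r := by linarith
  have h3 : δ * i * r.den < 1 := by
    have : (i : ℝ) < N + 1 := by exact_mod_cast Nat.lt_succ_of_le hi
    rw [hδ, div_mul_eq_mul_div, div_mul_eq_mul_div, div_lt_one (by positivity)]
    nlinarith
  have h4 : (-1 : ℝ) < l * r.den - i * r.num := by
    rw [← hr, ← hl]
    nlinarith
  have h5 : (0 : ℤ) ≤ l * r.den - i * r.num := by
    have : (-1 : ℤ) < l * r.den - i * r.num := by exact_mod_cast h4
    omega
  have h6 : (0 : ℝ) ≤ l * r.den - i * r.num := by exact_mod_cast h5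
  rw [← hr, ← hl] at h6
  have h7 : 0 ≤ (birkhoffSum g φ i (g^[j] x) - i * r) * r.den := by linarith
  exact sub_nonneg.mp (nonneg_of_mul_nonneg_left h7 hden)

/-- A rational maximal rotation number is that of a periodic point in the closure of the set of
reached points. -/
theorem exists_periodic_of_max (H : FoldSystem a t e g φ k) {r : ℚ} (hkr : (k : ℝ) < r) {x : ℝ}
    (hx : x ∈ Icc a t ∩ free a g)
    (hxr : Tendsto (fun m : ℕ => birkhoffSum g φ m x / m) atTop (𝓝 (r : ℝ)))
    (hmax : ∀ y ∈ Icc a t ∩ free a g, ∀ ρ,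
      Tendsto (fun m : ℕ => birkhoffSum g φ m y / m) atTop (𝓝 ρ) → ρ ≤ r) :
    ∃ p ∈ closure (reach a t g) ∩ free a g, ∃ n, 1 ≤ n ∧ g^[n] p = p ∧
      birkhoffSum g φ n p = n * (r : ℝ) := by
  let Q : ℕ → Set ℝ := fun N =>
    closure (reach a t g) ∩ {z | ∀ i ≤ N, i * (r : ℝ) ≤ birkhoffSum g φ i z}
  have hPc : IsCompact (closure (reach a t g)) :=
    isCompact_Icc.of_isClosed_subset isClosed_closure H.closure_reach_subset
  have hQcl : ∀ N, IsClosed {z | ∀ i ≤ N, i * (r : ℝ) ≤ birkhoffSum g φ i z} := fun N => by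
    have : {z | ∀ i ≤ N, i * (r : ℝ) ≤ birkhoffSum g φ i z}
        = ⋂ i ≤ N, {z | i * (r : ℝ) ≤ birkhoffSum g φ i z} := by ext; simp
    rw [this]
    exact isClosed_biInter fun i _ => isClosed_le continuous_const (H.continuous_birkhoffSum i)
  have hne : (⋂ N, Q N).Nonempty :=
    IsCompact.nonempty_iInter_of_sequence_nonempty_isCompact_isClosed Q
      (fun N z hz => ⟨hz.1, fun i hi => hz.2 i (Nat.le_succ_of_le hi)⟩)
      (fun N => by
        obtain ⟨z, hz, hz'⟩ := H.exists_forall_le_birkhoffSum hx hxr N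
        exact ⟨z, subset_closure hz, hz'⟩)
      (hPc.inter_right (hQcl 0)) (fun N => isClosed_closure.inter (hQcl N))
  have hmem : ∀ z, z ∈ ⋂ N, Q N ↔
      z ∈ closure (reach a t g) ∧ ∀ i : ℕ, i * (r : ℝ) ≤ birkhoffSum g φ i z := fun z => by
    rw [mem_iInter]
    exact ⟨fun h => ⟨(h 0).1, fun i => (h i).2 i le_rfl⟩, fun h N => ⟨h.1, fun i _ => h.2 i⟩⟩
  obtain ⟨z, hz, hzmin⟩ := IsCompact.exists_isLeast (hPc.of_isClosed_subset
    (isClosed_iInter fun N => isClosed_closure.inter (hQcl N))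
    fun z hz => ((hmem z).mp hz).1) hne
  rw [hmem] at hz
  have hze := H.closure_reach_subset hz.1
  -- Once at `a` the sum grows only at rate `k < r`, so it would fall below the required bound.
  have hzfree : z ∈ free a g := by
    intro i
    refine lt_of_le_of_ne (H.iterate_mem hze i).1 fun hi => ?_
    obtain ⟨m, hm⟩ := exists_nat_gt ((birkhoffSum g φ i z - i * r) / (r - k))
    rw [div_lt_iff₀ (by linarith)] at hm
    have := hz.2 (i + m)
    rw [birkhoffSum_add, ← hi, H.birkhoffSum_fix] at this
    push_cast at this
    linarith
  have hden : (0 : ℝ) < r.den := by exact_mod_cast r.pos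
  have hr : (r : ℝ) * r.den = r.num := by exact_mod_cast Rat.mul_den_eq_num r
  have hnat : ∀ i : ℕ, ∃ l : ℕ, (birkhoffSum g φ i z - i * r) * r.den = l := fun i => by
    obtain ⟨l, hl⟩ := H.exists_int_birkhoffSum hze hzfree i
    have h1 : (birkhoffSum g φ i z - i * r) * r.den = (l * r.den - i * r.num : ℤ) := by
      push_cast
      rw [← hr, hl]
      ring
    have h2 : (0 : ℤ) ≤ l * r.den - i * r.num := by
      have := mul_nonneg (sub_nonneg.mpr (hz.2 i)) hden.le
      rw [h1] at this
      exact_mod_cast this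
    obtain ⟨m, hm⟩ := Int.eq_ofNat_of_zero_le h2
    exact ⟨m, by rw [h1, hm]; rfl⟩
  choose D hD using hnat
  -- Minimality of the excess at time `n` is what puts `g^[n] z` in the same set; since `z` is the
  -- least element, `z ≤ g^[n] z`, and the interval pulled back from `z` covers itself.
  obtain ⟨n, hn, hnmin⟩ : ∃ n, 1 ≤ n ∧ ∀ i, 1 ≤ i → D n ≤ D i := by
    obtain ⟨n, hn, hmin⟩ := (measure D).wf.has_min {i | 1 ≤ i} ⟨1, le_refl 1⟩
    exact ⟨n, hn, fun i hi => not_lt.mp (hmin i hi)⟩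
  have hnQ : g^[n] z ∈ ⋂ N, Q N := by
    refine (hmem _).mpr ⟨H.iterate_mem_closure_reach hz.1 n, fun i => ?_⟩
    have h1 : (D n : ℝ) ≤ D (n + i) := by exact_mod_cast hnmin (n + i) (by omega)
    rw [← hD, ← hD, birkhoffSum_add] at h1
    have h2 := le_of_mul_le_mul_right h1 hden
    push_cast at h2
    linarith
  have hzn := hzmin hnQ
  obtain ⟨u, v, h1, h2, h3, h4, h5⟩ := H.pull hn z hze fun i _ _ => hzfree i
  obtain ⟨p, hp, hfix⟩ := exists_fixed_of_Icc_subset_image (H.continuous_iterate n) h2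
    ((Icc_subset_Icc h1 (h3.trans hzn)).trans h5)
  have hpP : p ∈ closure (reach a t g) :=
    H.mem_closure_reach_of_le hz.1 (h1.trans hp.1) (hp.2.trans h3)
  have hge : n * (r : ℝ) ≤ birkhoffSum g φ n p := by rw [h4 p hp]; exact hz.2 n
  have hn0 : (0 : ℝ) < n := by exact_mod_cast hn
  have hpa : p ≠ a := by
    rintro rfl
    rw [H.birkhoffSum_fix] at hge
    exact absurd (lt_of_mul_lt_mul_left (mul_lt_mul_of_pos_left hkr hn0) hn0.le)
      (not_lt.mpr (le_of_mul_le_mul_left hge hn0))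
  exact ⟨p, ⟨hpP, H.mem_free_of_periodic (H.closure_reach_subset hpP) hn hfix hpa⟩, n, hn, hfix,
    le_antisymm (H.birkhoffSum_le_of_periodic hkr.le hmax hpP hn hfix) hge⟩

/-- The part of the rotation interval of the leftmost interval above `k`. -/
theorem exists_upper_end (H : FoldSystem a t e g φ k) : ∃ d : ℝ, k ≤ d ∧
    (∀ x ∈ Icc a t ∩ free a g, ∀ ε > 0, ∀ᶠ n : ℕ in atTop, birkhoffSum g φ n x / n ≤ d + ε) ∧
    (∀ α : ℝ, k < α → α ≤ d → ∃ y ∈ Icc a t ∩ free a g,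
      Tendsto (fun n : ℕ => birkhoffSum g φ n y / n) atTop (𝓝 α)) ∧
    (∀ r : ℚ, (k : ℝ) < r → (r : ℝ) < d → ∃ p ∈ Icc a t ∩ free a g, ∃ n, 1 ≤ n ∧ g^[n] p = p ∧
      birkhoffSum g φ n p = n * (r : ℝ)) ∧
    (∀ r : ℚ, (k : ℝ) < r → (r : ℝ) = d → ∃ p ∈ closure (reach a t g) ∩ free a g, ∃ n, 1 ≤ n ∧
      g^[n] p = p ∧ birkhoffSum g φ n p = n * (r : ℝ)) := by
  -- `U` may be empty or lie below `k`; inserting `k` before taking the supremum ensures `k ≤ d`.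
  let U : Set ℝ := {β | ∃ x ∈ Icc a t ∩ free a g, ∃ᶠ n : ℕ in atTop, β ≤ birkhoffSum g φ n x / n}
  obtain ⟨C, hC0, hC⟩ := H.exists_bound
  have hbdd : BddAbove (insert (k : ℝ) U) := by
    refine BddAbove.insert _ ⟨C, ?_⟩
    rintro β ⟨x, hx, hβ⟩
    obtain ⟨n, hn⟩ := hβ.exists
    refine hn.trans (div_le_of_le_mul₀ (Nat.cast_nonneg n) hC0 ?_)
    exact (le_abs_self _).trans (H.abs_birkhoffSum_le hC (H.Icc_subset hx.1) n)
  have hloop : ∀ r : ℚ, (k : ℝ) < r → (r : ℝ) < sSup (insert (k : ℝ) U) →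
      ∃ n u v, IsLoop a t g φ n (n * r) u v := by
    intro r hkr hr
    obtain ⟨β, hβ, hrβ⟩ := exists_lt_of_lt_csSup (insert_nonempty _ _) hr
    rcases hβ with rfl | ⟨x, hx, hβ⟩
    · exact absurd hrβ (not_lt.mpr hkr.le)
    · exact H.exists_isLoop hx hβ hkr hrβ
  have hne : ∀ {r : ℚ} {n : ℕ} {u v : ℝ}, (k : ℝ) < r → IsLoop a t g φ n (n * r) u v →
      (n : ℝ) * r ≠ n * k := fun {r n u v} hkr h => by
    have hn0 : (0 : ℝ) < n := by exact_mod_cast h.pos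
    exact (mul_lt_mul_of_pos_left hkr hn0).ne'
  have hup : ∀ x ∈ Icc a t ∩ free a g, ∀ ε > 0, ∀ᶠ n : ℕ in atTop,
      birkhoffSum g φ n x / n ≤ sSup (insert (k : ℝ) U) + ε := by
    intro x hx ε hε
    by_contra hcon
    have : sSup (insert (k : ℝ) U) + ε ∈ U :=
      ⟨x, hx, (not_eventually.mp hcon).mono fun n hn => (not_le.mp hn).le⟩
    have := le_csSup hbdd (mem_insert_of_mem _ this)
    linarith
  have htend : ∀ α : ℝ, k < α → α ≤ sSup (insert (k : ℝ) U) → ∃ y ∈ Icc a t ∩ free a g,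
      Tendsto (fun n : ℕ => birkhoffSum g φ n y / n) atTop (𝓝 α) := by
    intro α hkα hα
    -- The approximation is strictly from below, so that the end `α = d` is covered as well.
    have hrat : ∀ j : ℕ, ∃ r : ℚ, max (k : ℝ) (α - 1 / (j + 1)) < r ∧ (r : ℝ) < α := fun j =>
      exists_rat_btwn (max_lt hkα (sub_lt_self α (by positivity)))
    choose r hr1 hr2 using hrat
    have hkr : ∀ j, (k : ℝ) < r j := fun j => (le_max_left _ _).trans_lt (hr1 j)
    choose n u v h using fun j => hloop (r j) (hkr j) ((hr2 j).trans_le hα)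
    refine H.exists_tendsto h (fun j => hne (hkr j) (h j)) ?_
    have hlow : Tendsto (fun j : ℕ => α - 1 / ((j : ℝ) + 1)) atTop (𝓝 α) := by
      simpa using tendsto_one_div_add_atTop_nhds_zero_nat.const_sub α
    refine tendsto_of_tendsto_of_tendsto_of_le_of_le hlow tendsto_const_nhds (fun j => ?_)
      fun j => ?_
    all_goals
      have hn0 : (n j : ℝ) ≠ 0 := by exact_mod_cast (Nat.one_le_iff_ne_zero.mp (h j).pos)
      simp only [mul_div_cancel_left₀ _ hn0]
    · exact ((le_max_right _ _).trans_lt (hr1 j)).le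
    · exact (hr2 j).le
  refine ⟨sSup (insert (k : ℝ) U), le_csSup hbdd (mem_insert _ _), hup, htend, ?_, ?_⟩
  · intro r hkr hr
    obtain ⟨n, u, v, h⟩ := hloop r hkr hr
    obtain ⟨p, hp, hfix, hS⟩ := h.exists_periodic H (hne hkr h)
    exact ⟨p, hp, n, h.pos, hfix, hS⟩
  · intro r hkr hr
    obtain ⟨x, hx, hxr⟩ := htend r hkr hr.le
    refine H.exists_periodic_of_max hkr hx hxr fun y hy ρ hρ => ?_
    rw [hr]
    exact le_of_forall_pos_le_add fun ε hε => le_of_tendsto hρ (hup y hy ε hε)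

end FoldSystem

/-! ### Translations and the retraction of a lifted graph -/

namespace LineShift

variable {T : Type*} [TopologicalSpace T] {L : LineShift T}

theorem translate_zero (x : T) : L.translate 0 x = x := rfl

theorem translate_one (x : T) : L.translate 1 x = L.τ x := by
  simp [translate]

theorem translate_add (j k : ℤ) (x : T) :
    L.translate (j + k) x = L.translate j (L.translate k x) := by
  simp [translate, zpow_add]

theorem translate_neg_translate (k : ℤ) (x : T) : L.translate (-k) (L.translate k x) = x := by
  rw [← translate_add, neg_add_cancel, translate_zero]

theorem translate_translate_neg (k : ℤ) (x : T) : L.translate k (L.translate (-k) x) = x := by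
  rw [← translate_add, add_neg_cancel, translate_zero]

theorem translate_injective (k : ℤ) : Function.Injective (L.translate k) :=
  (L.τ.toEquiv ^ k : Equiv.Perm T).injective

theorem translate_neg_one (x : T) : L.translate (-1) x = L.τ.symm x := by
  rw [← L.τ.symm_apply_apply (L.translate (-1) x), ← translate_one, translate_translate_neg]

theorem continuous_translate (k : ℤ) : Continuous (L.translate k) := by
  induction k using Int.induction_on with
  | zero => exact continuous_id
  | succ n ih =>
    refine (L.τ.continuous.comp ih).congr fun x => ?_
    rw [add_comm, translate_add, translate_one]; rfl
  | pred n ih =>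
    refine (L.τ.symm.continuous.comp ih).congr fun x => ?_
    rw [sub_eq_add_neg, add_comm, translate_add, translate_neg_one]; rfl

theorem image_translate_eq_preimage (k : ℤ) (S : Set T) :
    L.translate k '' S = L.translate (-k) ⁻¹' S :=
  congrFun (image_eq_preimage_of_inverse (translate_neg_translate k)
    (translate_translate_neg k)) S

theorem isOpen_image_translate (k : ℤ) {S : Set T} (hS : IsOpen S) :
    IsOpen (L.translate k '' S) := by
  rw [image_translate_eq_preimage]
  exact hS.preimage (continuous_translate _)

theorem isClosed_image_translate (k : ℤ) {S : Set T} (hS : IsClosed S) :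
    IsClosed (L.translate k '' S) := by
  rw [image_translate_eq_preimage]
  exact hS.preimage (continuous_translate _)

theorem translate_mem_of_image_eq {S : Set T} (hS : L.τ '' S = S) (k : ℤ) {x : T} (hx : x ∈ S) :
    L.translate k x ∈ S := by
  induction k using Int.induction_on with
  | zero => exact hx
  | succ n ih =>
    rw [add_comm, translate_add, translate_one, ← hS]
    exact mem_image_of_mem _ ih
  | pred n ih =>
    rw [sub_eq_add_neg, add_comm, translate_add, translate_neg_one]
    rw [← hS] at ih
    obtain ⟨y, hy, h⟩ := ih
    rwa [← h, L.τ.symm_apply_apply]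

theorem map_translate {F : T → T} (hF : L.IsDegreeOne F) (k : ℤ) (x : T) :
    F (L.translate k x) = L.translate k (F x) := by
  induction k using Int.induction_on with
  | zero => rfl
  | succ n ih =>
    rw [add_comm, translate_add, translate_one, hF.2, ih, translate_add, translate_one]
  | pred n ih =>
    rw [sub_eq_add_neg, add_comm, translate_add, translate_neg_one, translate_add,
      translate_neg_one, ← ih, L.τ.eq_symm_apply, ← hF.2, L.τ.apply_symm_apply]

theorem iterate_translate {F : T → T} (hF : L.IsDegreeOne F) (n : ℕ) (k : ℤ) (x : T) :
    F^[n] (L.translate k x) = L.translate k (F^[n] x) := by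
  induction n with
  | zero => rfl
  | succ n ih =>
    rw [Function.iterate_succ_apply', ih, map_translate hF, ← Function.iterate_succ_apply' F]

theorem mem_addInt {S : Set T} {x : T} : x ∈ L.addInt S ↔ ∃ k, ∃ y ∈ S, L.translate k y = x := by
  simp [addInt]

namespace IsLiftedGraph

theorem retr_h (hL : L.IsLiftedGraph) (z : ℝ) : L.retr (L.h z) = z := by
  have hz : L.h z ∈ L.line := mem_range_self z
  rw [retr, if_pos hz]
  exact hL.isEmbedding_h.injective
    (Classical.epsilon_spec (p := fun w : ℝ => L.h w = L.h z) ⟨z, rfl⟩)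

theorem retr_eq_of_mem_closure (hL : L.IsLiftedGraph) {x : T} (hx : x ∉ L.line) {z : ℝ}
    (hz : L.h z ∈ closure (L.comp x)) : L.retr x = z := by
  rw [retr, if_neg hx]
  have h := Classical.epsilon_spec (p := fun w : ℝ => L.h w ∈ closure (L.comp x)) ⟨z, hz⟩
  obtain ⟨w, hw⟩ := hL.closure_comp_inter x hx
  have h1 : ∀ v, L.h v ∈ closure (L.comp x) → L.h v = L.h w := fun v hv => by
    have : L.h v ∈ closure (L.comp x) ∩ L.line := ⟨hv, mem_range_self v⟩
    rwa [hw] at this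
  exact hL.isEmbedding_h.injective ((h1 _ h).trans (h1 _ hz).symm)

theorem h_retr_mem_closure (hL : L.IsLiftedGraph) {x : T} (hx : x ∉ L.line) :
    L.h (L.retr x) ∈ closure (L.comp x) := by
  obtain ⟨w, hw⟩ := hL.closure_comp_inter x hx
  have hw' : L.h w ∈ closure (L.comp x) ∩ L.line := hw ▸ rfl
  rw [hL.retr_eq_of_mem_closure hx hw'.1]
  exact hw'.1

theorem image_line (hL : L.IsLiftedGraph) : L.τ '' L.line = L.line := by
  refine Subset.antisymm ?_ ?_
  · rintro _ ⟨_, ⟨z, rfl⟩, rfl⟩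
    exact ⟨z + 1, (hL.shift_h z).symm⟩
  · rintro _ ⟨z, rfl⟩
    exact ⟨L.h (z - 1), ⟨z - 1, rfl⟩, by rw [hL.shift_h, sub_add_cancel]⟩

theorem retr_τ (hL : L.IsLiftedGraph) (x : T) : L.retr (L.τ x) = L.retr x + 1 := by
  by_cases hx : x ∈ L.line
  · obtain ⟨z, rfl⟩ := hx
    rw [hL.shift_h, hL.retr_h, hL.retr_h]
  · have hτ : L.τ '' L.lineᶜ = L.lineᶜ := by
      rw [image_compl_eq L.τ.bijective, hL.image_line]
    have hx' : L.τ x ∉ L.line := by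
      have : L.τ x ∈ L.τ '' L.lineᶜ := mem_image_of_mem _ hx
      rwa [hτ] at this
    refine hL.retr_eq_of_mem_closure hx' ?_
    have hc : L.comp (L.τ x) = L.τ '' L.comp x := by
      rw [comp, comp, L.τ.image_connectedComponentIn hx, hτ]
    rw [hc, ← L.τ.image_closure, ← hL.shift_h]
    exact mem_image_of_mem _ (hL.h_retr_mem_closure hx)

theorem retr_translate (hL : L.IsLiftedGraph) (k : ℤ) (x : T) :
    L.retr (L.translate k x) = L.retr x + k := by
  induction k using Int.induction_on with
  | zero => simp [translate_zero]
  | succ n ih =>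
    rw [add_comm, translate_add, translate_one, hL.retr_τ, ih]
    push_cast; ring
  | pred n ih =>
    have := hL.retr_τ (L.translate (-(n : ℤ) - 1) x)
    rw [← translate_one, ← translate_add, add_sub_cancel, ih] at this
    push_cast at this ⊢
    linarith

theorem retr_eq_of_mem_comp (_hL : L.IsLiftedGraph) {x y : T} (hx : x ∉ L.line)
    (hy : y ∈ L.comp x) : L.retr y = L.retr x := by
  have hy' : y ∉ L.line := connectedComponentIn_subset _ _ hy
  rw [retr, retr, if_neg hx, if_neg hy', comp, comp, connectedComponentIn_eq hy]

end IsLiftedGraph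

theorem line_subset_TR (F : T → T) : L.line ⊆ L.TR F := fun x hx =>
  subset_closure (mem_iUnion.mpr ⟨0, x, hx, rfl⟩)

theorem translate_mem_TR (hL : L.IsLiftedGraph) {F : T → T} (hF : L.IsDegreeOne F) (k : ℤ) {x : T}
    (hx : x ∈ L.TR F) : L.translate k x ∈ L.TR F := by
  refine map_mem_closure (continuous_translate k) hx fun y hy => ?_
  obtain ⟨n, w, hw, rfl⟩ := mem_iUnion.mp hy
  exact mem_iUnion.mpr ⟨n, L.translate k w, translate_mem_of_image_eq hL.image_line k hw,
    iterate_translate hF n k w⟩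

theorem translate_mem_TR_iff (hL : L.IsLiftedGraph) {F : T → T} (hF : L.IsDegreeOne F) (k : ℤ)
    {x : T} : L.translate k x ∈ L.TR F ↔ x ∈ L.TR F :=
  ⟨fun h => by simpa [translate_neg_translate] using translate_mem_TR hL hF (-k) h,
    translate_mem_TR hL hF k⟩

/-! ### The branch `X_F` and the projection onto its end part -/

namespace IsBranch

variable {F : T → T} {γ : unitInterval → T}

theorem mem_XF (hγ : L.IsBranch F γ) (u : unitInterval) : γ u ∈ L.XF F :=
  hγ.range_eq ▸ mem_range_self u

theorem notMem_TR (hγ : L.IsBranch F γ) {u : unitInterval} (hu : 0 < u) : γ u ∉ L.TR F := fun h => by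
  have : γ u ∈ L.XF F ∩ L.TR F := ⟨hγ.mem_XF u, h⟩
  rw [hγ.inter_eq] at this
  exact hu.ne' (hγ.injective this)

theorem zero_mem_TR (hγ : L.IsBranch F γ) : γ 0 ∈ L.TR F := by
  have : γ 0 ∈ L.XF F ∩ L.TR F := hγ.inter_eq ▸ rfl
  exact this.2

/-- Without its origin the branch is connected and off the line, hence inside one component; the
origin follows by continuity. The retraction therefore tells the translates of the branch apart. -/
theorem retr_eq (hγ : L.IsBranch F γ) (hL : L.IsLiftedGraph) (u : unitInterval) :
    L.retr (γ u) = L.retr (γ 1) := by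
  have hpos : ∀ u ∈ Ioi (0 : unitInterval), L.retr (γ u) = L.retr (γ 1) := by
    intro u hu
    have hline : γ '' Ioi 0 ⊆ L.lineᶜ := by
      rintro _ ⟨v, hv, rfl⟩ h
      exact hγ.notMem_TR hv (line_subset_TR F h)
    have h1 : γ 1 ∈ γ '' Ioi 0 := mem_image_of_mem _ (show (0 : unitInterval) < 1 from zero_lt_one)
    refine hL.retr_eq_of_mem_comp (hline h1) ?_
    exact (isPreconnected_Ioi.image γ hγ.continuous.continuousOn).subset_connectedComponentIn h1
      hline (mem_image_of_mem _ hu)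
  have hcl : IsClosed {u | L.retr (γ u) = L.retr (γ 1)} :=
    isClosed_eq (hL.continuous_retr.comp hγ.continuous) continuous_const
  have := closure_minimal (s := Ioi (0 : unitInterval)) hpos hcl
  rw [closure_Ioi' ⟨1, zero_lt_one⟩] at this
  exact this (show (0 : unitInterval) ≤ u from u.2.1)

theorem retr_translate_eq (hγ : L.IsBranch F γ) (hL : L.IsLiftedGraph) (k : ℤ) (u : unitInterval) :
    L.retr (L.translate k (γ u)) = L.retr (γ 1) + k := by
  rw [hL.retr_translate, hγ.retr_eq hL]

theorem translate_inj (hγ : L.IsBranch F γ) (hL : L.IsLiftedGraph) {j k : ℤ} {u v : unitInterval}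
    (h : L.translate j (γ u) = L.translate k (γ v)) : j = k ∧ u = v := by
  have h1 := congrArg L.retr h
  rw [hγ.retr_translate_eq hL, hγ.retr_translate_eq hL, add_right_inj] at h1
  have h2 : j = k := by exact_mod_cast h1
  subst h2
  exact ⟨rfl, hγ.injective (translate_injective j h)⟩

theorem exists_translate (hγ : L.IsBranch F γ) (hL : L.IsLiftedGraph) (hF : L.IsDegreeOne F)
    {w : T} (hw : w ∉ L.TR F) : ∃ k u, 0 < u ∧ w = L.translate k (γ u) := by
  set k := ⌊L.retr w⌋ with hk
  have hw' : L.translate (-k) w ∉ L.TR F := fun h => hw ((translate_mem_TR_iff hL hF _).mp h)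
  have hX : L.translate (-k) w ∈ L.XF F := by
    refine ⟨subset_closure hw', ?_⟩
    rw [mem_preimage, hL.retr_translate]
    push_cast
    constructor
    · linarith [Int.floor_le (L.retr w)]
    · linarith [Int.lt_floor_add_one (L.retr w)]
  rw [← hγ.range_eq] at hX
  obtain ⟨u, hu⟩ := hX
  refine ⟨k, u, lt_of_le_of_ne u.2.1 fun h => ?_, by rw [hu, translate_translate_neg]⟩
  have : u = 0 := h.symm
  exact hw' (hu ▸ this ▸ hγ.zero_mem_TR)

theorem exists_eq (hγ : L.IsBranch F γ) (hL : L.IsLiftedGraph) (hF : L.IsDegreeOne F)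
    {w : T} (hw : w ∉ L.TR F) (hr : L.retr w ∈ Ioo (L.retr (γ 1) - 1) (L.retr (γ 1) + 1)) :
    ∃ u, 0 < u ∧ w = γ u := by
  obtain ⟨k, u, hu, rfl⟩ := hγ.exists_translate hL hF hw
  rw [hγ.retr_translate_eq hL] at hr
  have h1 : (k : ℝ) < 1 := by linarith [hr.2]
  have h2 : (-1 : ℝ) < k := by linarith [hr.1]
  have h3 : k < 1 := by exact_mod_cast h1
  have h4 : -1 < k := by exact_mod_cast h2
  obtain rfl : k = 0 := by omega
  exact ⟨u, hu, rfl⟩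

open Classical in
/-- The parameter of the projection of a point, modulo translations, to the end part
`γ '' Ici b` of the branch: all points off its translates are sent to its origin. -/
noncomputable def proj (L : LineShift T) (γ : unitInterval → T) (b : unitInterval) (w : T) :
    unitInterval :=
  if h : ∃ v, b < v ∧ ∃ k, w = L.translate k (γ v) then h.choose else b

theorem proj_translate (hγ : L.IsBranch F γ) (hL : L.IsLiftedGraph) {b v : unitInterval}
    (hbv : b ≤ v) (k : ℤ) : proj L γ b (L.translate k (γ v)) = v := by
  by_cases h : ∃ v', b < v' ∧ ∃ k', L.translate k (γ v) = L.translate k' (γ v')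
  · rw [proj, dif_pos h]
    obtain ⟨k', hk'⟩ := h.choose_spec.2
    exact (hγ.translate_inj hL hk').2.symm
  · rw [proj, dif_neg h]
    exact hbv.eq_or_lt.resolve_right fun hlt => h ⟨v, hlt, k, rfl⟩

theorem exists_of_lt_proj {b : unitInterval} {w : T} (h : b < proj L γ b w) :
    ∃ k, w = L.translate k (γ (proj L γ b w)) := by
  rw [proj] at h ⊢
  split_ifs at h ⊢ with hex
  · exact hex.choose_spec.2
  · exact absurd h (lt_irrefl b)

theorem le_proj (b : unitInterval) (w : T) : b ≤ proj L γ b w := by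
  rw [proj]
  split_ifs with hex
  · exact hex.choose_spec.1.le
  · exact le_rfl

variable [T2Space T]

/-- Off `T_ℝ`, the points whose retraction is at distance less than 1 from that of the branch all
lie on the branch; what remains is to remove a compact initial segment. -/
theorem isOpen_image_Ioi (hγ : L.IsBranch F γ) (hL : L.IsLiftedGraph) (hF : L.IsDegreeOne F)
    (u : unitInterval) : IsOpen (γ '' Ioi u) := by
  have : γ '' Ioi u = (L.TR F)ᶜ ∩ L.retr ⁻¹' Ioo (L.retr (γ 1) - 1) (L.retr (γ 1) + 1)
      ∩ (γ '' Iic u)ᶜ := by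
    refine Subset.antisymm ?_ ?_
    · rintro _ ⟨v, hv, rfl⟩
      refine ⟨⟨hγ.notMem_TR (lt_of_le_of_lt u.2.1 hv), ?_⟩, ?_⟩
      · rw [mem_preimage, hγ.retr_eq hL v]
        exact ⟨sub_one_lt _, lt_add_one _⟩
      · rintro ⟨v', hv', h⟩
        rw [hγ.injective h] at hv'
        exact not_lt.mpr (mem_Iic.mp hv') (mem_Ioi.mp hv)
    · rintro w ⟨⟨hw, hr⟩, hu⟩
      obtain ⟨v, hv, rfl⟩ := hγ.exists_eq hL hF hw hr
      exact mem_image_of_mem _ (mem_Ioi.mpr (not_le.mp fun h => hu (mem_image_of_mem _ (mem_Iic.mpr h))))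
  rw [this]
  exact (isClosed_closure.isOpen_compl.inter (isOpen_Ioo.preimage hL.continuous_retr)).inter
    (isClosed_Iic.isCompact.image hγ.continuous).isClosed.isOpen_compl

theorem isClosed_image_Ici (hγ : L.IsBranch F γ) (u : unitInterval) : IsClosed (γ '' Ici u) :=
  (isClosed_Ici.isCompact.image hγ.continuous).isClosed

/-- If `γ u` were not in `T'`, the open sets `γ '' Ioi u` and `(γ '' Ici u)ᶜ` would disconnect `T'`.
-/
theorem mem_of_le (hγ : L.IsBranch F γ) (hL : L.IsLiftedGraph) (hF : L.IsDegreeOne F)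
    {T' : Set T} (hconn : IsConnected T') (hTR : L.TR F ⊆ T') {u v : unitInterval}
    (hv : γ v ∈ T') (huv : u ≤ v) : γ u ∈ T' := by
  rcases u.2.1.eq_or_lt with h0 | h0
  · rw [show u = 0 from Subtype.ext h0.symm]
    exact hTR hγ.zero_mem_TR
  by_contra hu
  have hlt : u < v := lt_of_le_of_ne huv fun h => hu (h ▸ hv)
  obtain ⟨w, -, ⟨p, hp, rfl⟩, hw⟩ := hconn.isPreconnected _ _ (hγ.isOpen_image_Ioi hL hF u)
    (hγ.isClosed_image_Ici u).isOpen_compl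
    (fun w hw => by
      by_cases h : w ∈ γ '' Ici u
      · obtain ⟨p, hp, rfl⟩ := h
        exact Or.inl (mem_image_of_mem _ (lt_of_le_of_ne (mem_Ici.mp hp) (by rintro rfl; exact hu hw)))
      · exact Or.inr h)
    ⟨γ v, hv, mem_image_of_mem _ hlt⟩
    ⟨γ 0, hTR hγ.zero_mem_TR, by
      rintro ⟨p, hp, h⟩
      rw [hγ.injective h] at hp
      exact not_lt.mpr (mem_Ici.mp hp) h0⟩
  exact hw (mem_image_of_mem _ (mem_Ici.mpr (le_of_lt (mem_Ioi.mp hp))))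

/-- Points outside `T'` accumulate at `γ b`, and those close to it are branch points before `γ v`;
but `T'` contains an initial part of the branch with each of its branch points. -/
theorem notMem_of_isLeast_lt (hγ : L.IsBranch F γ) (hL : L.IsLiftedGraph) (hF : L.IsDegreeOne F)
    {T' : Set T} (hconn : IsConnected T') (hTR : L.TR F ⊆ T') {b v : unitInterval}
    (hb : IsLeast (γ ⁻¹' L.coreg T') b) (hbv : b < v) : γ v ∉ T' := by
  intro hv
  have hnhds : γ b ∈ L.retr ⁻¹' Ioo (L.retr (γ 1) - 1) (L.retr (γ 1) + 1) ∩ (γ '' Ici v)ᶜ := by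
    constructor
    · rw [mem_preimage, hγ.retr_eq hL b]
      exact ⟨sub_one_lt _, lt_add_one _⟩
    · rintro ⟨p, hp, h⟩
      rw [hγ.injective h] at hp
      exact not_lt.mpr (mem_Ici.mp hp) hbv
  obtain ⟨w, ⟨hw1, hw2⟩, hw⟩ := mem_closure_iff.mp hb.1.1 _
    ((isOpen_Ioo.preimage hL.continuous_retr).inter (hγ.isClosed_image_Ici v).isOpen_compl) hnhds
  obtain ⟨p, -, rfl⟩ := hγ.exists_eq hL hF (fun h => hw (hTR h)) hw1
  refine hw (hγ.mem_of_le hL hF hconn hTR hv (le_of_lt (not_le.mp fun h => ?_)))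
  exact hw2 (mem_image_of_mem _ h)

theorem coreg_eq (hγ : L.IsBranch F γ) (hL : L.IsLiftedGraph) (hF : L.IsDegreeOne F)
    {T' : Set T} (hconn : IsConnected T') (hTR : L.TR F ⊆ T') {b : unitInterval}
    (hb : IsLeast (γ ⁻¹' L.coreg T') b) : L.coreg T' = γ '' Ici b := by
  refine Subset.antisymm ?_ ?_
  · intro w hw
    have : w ∈ L.XF F := ⟨closure_mono (compl_subset_compl.mpr hTR) hw.1, hw.2⟩
    rw [← hγ.range_eq] at this
    obtain ⟨u, rfl⟩ := this
    exact mem_image_of_mem _ (hb.2 hw)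
  · rintro _ ⟨v, hv, rfl⟩
    rcases (mem_Ici.mp hv).eq_or_lt with rfl | h
    · exact hb.1
    · exact ⟨subset_closure (hγ.notMem_of_isLeast_lt hL hF hconn hTR hb h), (hγ.mem_XF v).2⟩

/-- The sets above a level are unions of translates of open end pieces. The sets below a level are
complements of unions of translates of compact end pieces, and these unions are closed: the
retraction shows that the translates form a locally finite family. -/
theorem continuous_proj (hγ : L.IsBranch F γ) (hL : L.IsLiftedGraph) (hF : L.IsDegreeOne F)
    (b : unitInterval) : Continuous (proj L γ b) := by
  rw [OrderTopology.continuous_iff]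
  refine fun c => ⟨?_, ?_⟩
  · rcases lt_or_ge c b with hc | hc
    · convert isOpen_univ
      exact eq_univ_of_forall fun w => hc.trans_le (le_proj b w)
    · have : proj L γ b ⁻¹' Ioi c = ⋃ k, L.translate k '' (γ '' Ioi c) := by
        ext w
        simp only [mem_preimage, mem_iUnion]
        constructor
        · intro h
          obtain ⟨k, hk⟩ := exists_of_lt_proj (hc.trans_lt h)
          exact ⟨k, _, mem_image_of_mem _ h, hk.symm⟩
        · rintro ⟨k, _, ⟨v, hv, rfl⟩, rfl⟩
          rwa [hγ.proj_translate hL (hc.trans (le_of_lt hv))]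
      rw [this]
      exact isOpen_iUnion fun k => isOpen_image_translate k (hγ.isOpen_image_Ioi hL hF c)
  · rcases le_or_gt c b with hc | hc
    · convert isOpen_empty
      exact eq_empty_of_forall_notMem fun w => not_lt.mpr (hc.trans (le_proj b w))
    · have : proj L γ b ⁻¹' Iio c = (⋃ k, L.translate k '' (γ '' Ici c))ᶜ := by
        ext w
        simp only [mem_preimage, mem_compl_iff, mem_iUnion, mem_Iio]
        rw [← not_le, not_iff_not]
        constructor
        · intro h
          obtain ⟨k, hk⟩ := exists_of_lt_proj (hc.trans_le h)
          exact ⟨k, _, mem_image_of_mem _ h, hk.symm⟩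
        · rintro ⟨k, _, ⟨v, hv, rfl⟩, rfl⟩
          rwa [hγ.proj_translate hL (hc.le.trans hv)]
      rw [this, isOpen_compl_iff]
      refine LocallyFinite.isClosed_iUnion (fun x => ?_) fun k =>
        isClosed_image_translate k (hγ.isClosed_image_Ici c)
      refine ⟨L.retr ⁻¹' Ioo (L.retr x - 1) (L.retr x + 1),
        (isOpen_Ioo.preimage hL.continuous_retr).mem_nhds ⟨by linarith, by linarith⟩, ?_⟩
      refine (finite_Icc ⌊L.retr x - 1 - L.retr (γ 1)⌋ ⌈L.retr x + 1 - L.retr (γ 1)⌉).subset ?_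
      rintro k ⟨_, ⟨_, ⟨v, -, rfl⟩, rfl⟩, hk⟩
      rw [mem_preimage, hγ.retr_translate_eq hL] at hk
      constructor
      · have : (⌊L.retr x - 1 - L.retr (γ 1)⌋ : ℝ) ≤ k :=
          (Int.floor_le _).trans (by linarith [hk.1])
        exact_mod_cast this
      · have : (k : ℝ) ≤ ⌈L.retr x + 1 - L.retr (γ 1)⌉ :=
          le_trans (by linarith [hk.2]) (Int.le_ceil _)
        exact_mod_cast this

end IsBranch

end LineShift

/-! ### Auxiliary facts on real maps and sequences -/

/-- Without a fixed point in `[s, x]` the graph is below the diagonal there, so the orbit decreases;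
its limit is a fixed point. -/
theorem exists_fixed_of_orbit_ge {f : ℝ → ℝ} (hf : Continuous f) {s x : ℝ} (hs : f s ≤ s)
    (horb : ∀ n : ℕ, s ≤ f^[n] x) : ∃ p ∈ Icc s x, f p = p := by
  by_contra! hcon
  have hsx : s ≤ x := horb 0
  have hlt : ∀ y ∈ Icc s x, f y < y := by
    intro y hy
    by_contra! h
    obtain ⟨p, hp, hp'⟩ := intermediate_value_Icc hy.1 (hf.sub continuous_id).continuousOn
      (show (0 : ℝ) ∈ Icc (f s - s) (f y - y) from ⟨by linarith, by linarith⟩)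
    exact hcon p ⟨hp.1, hp.2.trans hy.2⟩ (sub_eq_zero.mp hp')
  have hmem : ∀ n : ℕ, f^[n] x ∈ Icc s x := by
    intro n
    induction n with
    | zero => exact ⟨hsx, le_rfl⟩
    | succ n ih =>
      refine ⟨horb _, ?_⟩
      rw [Function.iterate_succ_apply']
      exact (hlt _ ih).le.trans ih.2
  have hanti : Antitone fun n : ℕ => f^[n] x := antitone_nat_of_succ_le fun n => by
    rw [Function.iterate_succ_apply']
    exact (hlt _ (hmem n)).le
  have hlim := tendsto_atTop_ciInf hanti ⟨s, by rintro _ ⟨n, rfl⟩; exact horb n⟩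
  have hfix := isFixedPt_of_tendsto_iterate hlim hf.continuousAt
  exact hcon _ (isClosed_Icc.mem_of_tendsto hlim (Eventually.of_forall hmem)) hfix

/-- By Tietze's theorem, since the intervals are disjoint and closed. The values in the gaps are
irrelevant: orbits that stay never visit them. -/
theorem exists_continuous_eq_on_Icc {m : ℕ} {s t : Fin m → ℝ} (hst : ∀ i j, i < j → t i < s j)
    (q : Fin m → ℤ) : ∃ φ : ℝ → ℝ, Continuous φ ∧ ∀ i, ∀ x ∈ Icc (s i) (t i), φ x = q i := by
  classical
  let φ₀ : ℝ → ℝ := fun x => if h : ∃ i, x ∈ Icc (s i) (t i) then (q h.choose : ℝ) else 0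
  have hφ₀ : ∀ i, ∀ x ∈ Icc (s i) (t i), φ₀ x = q i := by
    intro i x hx
    have h : ∃ i, x ∈ Icc (s i) (t i) := ⟨i, hx⟩
    simp only [φ₀, dif_pos h]
    have hc := h.choose_spec
    have : h.choose = i := by
      rcases lt_trichotomy h.choose i with hlt | heq | hlt
      · have := hst _ _ hlt
        linarith [hc.2, hx.1]
      · exact heq
      · have := hst _ _ hlt
        linarith [hc.1, hx.2]
    rw [this]
  have hcont : ContinuousOn φ₀ (⋃ i, Icc (s i) (t i)) :=
    (locallyFinite_of_finite _).continuousOn_iUnion (fun i => isClosed_Icc) fun i =>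
      continuousOn_const.congr (hφ₀ i)
  have hcl : IsClosed (⋃ i, Icc (s i) (t i)) := isClosed_iUnion_of_finite fun i => isClosed_Icc
  obtain ⟨φ, hφ⟩ := ContinuousMap.exists_restrict_eq hcl ⟨_, hcont.domRestrict⟩
  refine ⟨φ, φ.continuous, fun i x hx => ?_⟩
  rw [← hφ₀ i x hx]
  exact DFunLike.congr_fun hφ ⟨x, mem_iUnion.mpr ⟨i, hx⟩⟩

theorem limsup_liminf_mem_Icc {u : ℕ → ℝ} {c d : ℝ} (hd : ∀ ε > 0, ∀ᶠ n in atTop, u n ≤ d + ε)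
    (hc : ∀ ε > 0, ∀ᶠ n in atTop, c - ε ≤ u n) :
    limsup u atTop ∈ Icc c d ∧ liminf u atTop ∈ Icc c d := by
  have hb1 : IsBoundedUnder (· ≤ ·) atTop u := isBoundedUnder_of_eventually_le (hd 1 one_pos)
  have hb2 : IsBoundedUnder (· ≥ ·) atTop u := isBoundedUnder_of_eventually_ge (hc 1 one_pos)
  have h1 : limsup u atTop ≤ d := le_of_forall_pos_le_add fun ε hε =>
    limsup_le_of_le hb2.isCoboundedUnder_le (hd ε hε)
  have h2 : c ≤ liminf u atTop := le_of_forall_pos_le_add fun ε hε => by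
    have := le_liminf_of_le hb1.isCoboundedUnder_ge (hc ε hε)
    linarith
  have h3 : liminf u atTop ≤ limsup u atTop := liminf_le_limsup hb1 hb2
  exact ⟨⟨h2.trans h3, h1⟩, h2, h3.trans h1⟩

/-! ### The interval model of a σ-like map -/

namespace LineShift

variable {T : Type*} [TopologicalSpace T] {L : LineShift T}

/-- The interval `Γ '' [b, e]`, whose points are mapped by `F`, as long as they come back to its
translates, according to the map `f` of `[b, e]`, with the displacement `q i` on `[s i, t i]`. -/
structure IsModel (L : LineShift T) (F : T → T) (Γ : ℝ → T) (z b e : ℝ) (f : ℝ → ℝ) {m : ℕ}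
    (s t : Fin (m + 1) → ℝ) (q : Fin (m + 1) → ℤ) : Prop where
  degree : L.IsDegreeOne F
  continuous_param : Continuous Γ
  continuous_map : Continuous f
  retr_eq : ∀ k x, L.retr (L.translate k (Γ x)) = z + k
  maps : ∀ x, f x ∈ Icc b e
  le_left : ∀ i, b ≤ s i
  le : ∀ i, s i ≤ t i
  le_right : ∀ i, t i ≤ e
  lt : ∀ i j, i < j → t i < s j
  map_eq : ∀ x ∈ Icc b e, F (Γ x) ∈ L.addInt (Γ '' Icc b e) → ∃ k, F (Γ x) = L.translate k (Γ (f x))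
  exists_mem : ∀ x ∈ Icc b e, F (Γ x) ∈ L.addInt (Γ '' Icc b e) → ∃ i, x ∈ Icc (s i) (t i)
  map_eq_of_lt : ∀ x ∈ Icc b e, b < f x →
    ∃ i, x ∈ Icc (s i) (t i) ∧ F (Γ x) = L.translate (q i) (Γ (f x))
  map_zero : f (s 0) = b
  base : s 0 = b → F (Γ b) = L.translate (q 0) (Γ b)

namespace IsModel

variable {F : T → T} {Γ : ℝ → T} {z b e : ℝ} {f : ℝ → ℝ} {m : ℕ} {s t : Fin (m + 1) → ℝ}
  {q : Fin (m + 1) → ℤ}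

/-- For `i ≠ 0` the points just to the left of `s i` are in none of the intervals, so `f = b` there,
and continuity gives the value at `s i`. -/
theorem map_left (K : L.IsModel F Γ z b e f s t q) (i : Fin (m + 1)) : f (s i) = b := by
  rcases eq_or_ne i 0 with rfl | hi
  · exact K.map_zero
  have hbs : b < s i := (K.le_left 0).trans_lt ((K.le 0).trans_lt (K.lt 0 i (Fin.pos_of_ne_zero hi)))
  have hnot : ∀ᶠ x in 𝓝[<] s i, ∀ j, x ∉ Icc (s j) (t j) := by
    rw [eventually_all]
    intro j
    rcases eq_or_ne j i with rfl | hj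
    · filter_upwards [self_mem_nhdsWithin] with x hx h
      exact not_lt.mpr h.1 hx
    · have : s i ∉ Icc (s j) (t j) := fun h => by
        rcases lt_or_gt_of_ne hj with hlt | hlt
        · exact not_lt.mpr h.2 (K.lt j i hlt)
        · exact not_lt.mpr h.1 ((K.le i).trans_lt (K.lt i j hlt))
      exact nhdsWithin_le_nhds (isClosed_Icc.isOpen_compl.mem_nhds this)
  have hev : ∀ᶠ x in 𝓝[<] s i, f x = b := by
    filter_upwards [hnot, self_mem_nhdsWithin, nhdsWithin_le_nhds (Ioi_mem_nhds hbs)] with x h1 h2 h3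
    have hx : x ∈ Icc b e :=
      ⟨le_of_lt h3, (le_of_lt h2).trans ((K.le i).trans (K.le_right i))⟩
    refine le_antisymm (not_lt.mp fun h => ?_) (K.maps x).1
    obtain ⟨j, hj, -⟩ := K.map_eq_of_lt x hx h
    exact h1 j hj
  exact tendsto_nhds_unique (K.continuous_map.continuousAt.mono_left nhdsWithin_le_nhds)
    (tendsto_const_nhds.congr' (hev.mono fun _ h => h.symm))

theorem step (K : L.IsModel F Γ z b e f s t q) {x : ℝ} (hx : x ∈ Icc b e)
    (hst : Γ x ∈ L.stay F (Γ '' Icc b e)) :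
    (∃ k, F (Γ x) = L.translate k (Γ (f x))) ∧ Γ (f x) ∈ L.stay F (Γ '' Icc b e) := by
  obtain ⟨k, hk⟩ := K.map_eq x hx (hst.2 1 le_rfl)
  refine ⟨⟨k, hk⟩, mem_image_of_mem _ (K.maps x), fun n _ => ?_⟩
  have h := hst.2 (n + 1) (by omega)
  rw [Function.iterate_succ_apply, hk, iterate_translate K.degree] at h
  obtain ⟨j, y, hy, hjy⟩ := mem_addInt.mp h
  refine mem_addInt.mpr ⟨-k + j, y, hy, ?_⟩
  rw [translate_add, hjy, translate_neg_translate]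

theorem orbit (K : L.IsModel F Γ z b e f s t q) {x : ℝ} (hx : x ∈ Icc b e)
    (hst : Γ x ∈ L.stay F (Γ '' Icc b e)) (n : ℕ) :
    f^[n] x ∈ Icc b e ∧ (∃ k, F^[n] (Γ x) = L.translate k (Γ (f^[n] x))) ∧
      Γ (f^[n] x) ∈ L.stay F (Γ '' Icc b e) := by
  induction n with
  | zero => exact ⟨hx, ⟨0, rfl⟩, hst⟩
  | succ n ih =>
    obtain ⟨h1, ⟨k, hk⟩, h3⟩ := ih
    obtain ⟨⟨j, hj⟩, h4⟩ := K.step h1 h3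
    rw [Function.iterate_succ_apply', Function.iterate_succ_apply']
    refine ⟨K.maps _, ⟨k + j, ?_⟩, h4⟩
    rw [hk, map_translate K.degree, hj, translate_add]

theorem exists_mem_of_stay (K : L.IsModel F Γ z b e f s t q) {x : ℝ} (hx : x ∈ Icc b e)
    (hst : Γ x ∈ L.stay F (Γ '' Icc b e)) : ∃ i, x ∈ Icc (s i) (t i) :=
  K.exists_mem x hx (hst.2 1 le_rfl)

theorem Icc_subset (K : L.IsModel F Γ z b e f s t q) (i : Fin (m + 1)) :
    Icc (s i) (t i) ⊆ Icc b e :=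
  Icc_subset_Icc (K.le_left i) (K.le_right i)

/-- The first fixed point of the leftmost interval is its first point that stays. -/
theorem exists_first_fixed (K : L.IsModel F Γ z b e f s t q)
    (hne : ∃ x ∈ Icc (s 0) (t 0), Γ x ∈ L.stay F (Γ '' Icc b e)) :
    ∃ a ∈ Icc (s 0) (t 0), f a = a ∧ F (Γ a) = L.translate (q 0) (Γ a) ∧
      ∀ x ∈ Icc b e, Γ x ∈ L.stay F (Γ '' Icc b e) → a ≤ x := by
  have hfix : ∀ x ∈ Icc (s 0) (t 0), Γ x ∈ L.stay F (Γ '' Icc b e) →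
      ∃ p ∈ Icc (s 0) x, f p = p := by
    intro x hx hst
    -- An orbit that stays visits only the intervals `[s i, t i]`, so it never goes below `s 0`,
    -- while `f (s 0) = b ≤ s 0`.
    refine exists_fixed_of_orbit_ge K.continuous_map (K.map_zero.trans_le (K.le_left 0)) fun n => ?_
    obtain ⟨h1, -, h2⟩ := K.orbit (K.Icc_subset 0 hx) hst n
    obtain ⟨i, hi⟩ := K.exists_mem_of_stay h1 h2
    rcases eq_or_ne i 0 with rfl | h
    · exact hi.1
    · exact (K.le 0).trans ((K.lt 0 i (Fin.pos_of_ne_zero h)).le.trans hi.1)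
  obtain ⟨x₀, hx₀, hst₀⟩ := hne
  obtain ⟨p₀, hp₀, hfp₀⟩ := hfix x₀ hx₀ hst₀
  obtain ⟨a, ⟨ha, hfa⟩, hmin⟩ : ∃ a, IsLeast (Icc (s 0) (t 0) ∩ {p | f p = p}) a :=
    (isCompact_Icc.inter_right (isClosed_eq K.continuous_map continuous_id)).exists_isLeast
      ⟨p₀, ⟨hp₀.1, hp₀.2.trans hx₀.2⟩, hfp₀⟩
  replace hfa : f a = a := hfa
  refine ⟨a, ha, hfa, ?_, fun x hx hst => ?_⟩
  -- The value `b` of `f` may come from a point off the translates of the interval, so for `a = b`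
  -- the equation `f a = a` does not determine `F (Γ a)`. In that case `s 0 = b` and `base` applies.
  · have hab := K.Icc_subset 0 ha
    rcases hab.1.eq_or_lt with h | h
    · have : s 0 = b := le_antisymm (ha.1.trans h.ge) (K.le_left 0)
      rw [← h]
      exact K.base this
    · obtain ⟨i, hi, hF⟩ := K.map_eq_of_lt a hab (by rwa [hfa])
      rcases eq_or_ne i 0 with rfl | hi0
      · rwa [hfa] at hF
      · exact absurd (ha.2.trans_lt (K.lt 0 i (Fin.pos_of_ne_zero hi0))) (not_lt.mpr hi.1)
  · obtain ⟨i, hi⟩ := K.exists_mem_of_stay hx hst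
    rcases eq_or_ne i 0 with rfl | hi0
    · obtain ⟨p, hp, hfp⟩ := hfix x hi hst
      exact (hmin ⟨⟨hp.1, hp.2.trans hi.2⟩, hfp⟩).trans hp.2
    · exact ha.2.trans ((K.lt 0 i (Fin.pos_of_ne_zero hi0)).le.trans hi.1)

/-- Cutting `f` off at `a` makes `a` the common image of all left ends: the first interval is
shortened to start at `a`, and on the others `f (s i) = b ≤ a`. -/
theorem foldSystem (K : L.IsModel F Γ z b e f s t q) {a : ℝ} (ha : a ∈ Icc (s 0) (t 0))
    (hfa : f a = a) {φ : ℝ → ℝ} (hφ : Continuous φ) (hφq : ∀ i, ∀ x ∈ Icc (s i) (t i), φ x = q i) :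
    FoldSystem a (t 0) e (fun x => max a (f x)) φ (q 0) where
  continuous_map := continuous_const.max K.continuous_map
  continuous_disp := hφ
  le_left := ha.2
  le_right := K.le_right 0
  fix := by simp [hfa]
  maps x := ⟨le_max_left _ _, max_le (ha.2.trans (K.le_right 0)) (K.maps x).2⟩
  base y hy := hφq 0 y ⟨ha.1.trans hy.1, hy.2⟩
  fold x hx hgx := by
    have hba := (K.Icc_subset 0 ha).1
    have hafx : a < f x := (lt_max_iff.mp hgx).resolve_left (lt_irrefl a)
    obtain ⟨i, hi, -⟩ := K.map_eq_of_lt x ⟨hba.trans hx.1, hx.2⟩ (hba.trans_lt hafx)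
    rcases eq_or_ne i 0 with rfl | hi0
    · exact ⟨a, ⟨le_rfl, hx.1⟩, by simp [hfa], q 0, fun y hy =>
        hφq 0 y ⟨ha.1.trans hy.1, hy.2.trans hi.2⟩⟩
    · refine ⟨s i, ⟨(ha.2.trans (K.lt 0 i (Fin.pos_of_ne_zero hi0)).le), hi.1⟩, ?_, q i, fun y hy =>
        hφq i y ⟨hy.1, hy.2.trans hi.2⟩⟩
      simp [K.map_left i, hba]

section Cut

variable {a : ℝ} {φ : ℝ → ℝ}

/-- As long as the truncated orbit is above `a`, the truncation has not acted and `f > b`, so each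
step of `F` is a translation by the exact `q i`. -/
theorem iterate_eq (K : L.IsModel F Γ z b e f s t q) (hba : b ≤ a)
    (hφq : ∀ i, ∀ x ∈ Icc (s i) (t i), φ x = q i) {x : ℝ} (hx : x ∈ Icc a e)
    (hae : a ≤ e) {n : ℕ} (hn : ∀ j, 1 ≤ j → j ≤ n → a < (fun x => max a (f x))^[j] x) :
    ∃ l : ℤ, birkhoffSum (fun x => max a (f x)) φ n x = l ∧
      F^[n] (Γ x) = L.translate l (Γ ((fun x => max a (f x))^[n] x)) := by
  induction n with
  | zero => exact ⟨0, by simp, rfl⟩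
  | succ n ih =>
    obtain ⟨l, hl, hF⟩ := ih fun j h1 h2 => hn j h1 (by omega)
    set y := (fun x => max a (f x))^[n] x with hy
    have hye : y ∈ Icc a e := by
      cases n with
      | zero => exact hx
      | succ n =>
        rw [hy, Function.iterate_succ_apply']
        exact ⟨le_max_left _ _, max_le hae (K.maps _).2⟩
    have hgy := hn (n + 1) (by omega) le_rfl
    rw [Function.iterate_succ_apply', ← hy] at hgy
    have hafy : a < f y := (lt_max_iff.mp hgy).resolve_left (lt_irrefl a)
    obtain ⟨i, hi, hFy⟩ := K.map_eq_of_lt y ⟨hba.trans hye.1, hye.2⟩ (hba.trans_lt hafy)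
    refine ⟨l + q i, ?_, ?_⟩
    · rw [birkhoffSum_succ, hl, ← hy, hφq i y hi]
      push_cast; rfl
    · rw [Function.iterate_succ_apply', hF, map_translate K.degree, hFy, translate_add,
        Function.iterate_succ_apply', ← hy, max_eq_right hafy.le]

theorem meanDisp_eq (K : L.IsModel F Γ z b e f s t q) {x y : ℝ} {n : ℕ} {l : ℤ}
    (h : F^[n] (Γ x) = L.translate l (Γ y)) : L.meanDisp F (Γ x) n = l / n := by
  have := K.retr_eq 0 x
  rw [translate_zero] at this
  rw [meanDisp, h, K.retr_eq, this]
  simp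

theorem meanDisp_eq_of_free (K : L.IsModel F Γ z b e f s t q) (hba : b ≤ a)
    (hφq : ∀ i, ∀ x ∈ Icc (s i) (t i), φ x = q i) {x : ℝ} (hx : x ∈ Icc a e)
    (hae : a ≤ e) (hfree : x ∈ FoldSystem.free a (fun x => max a (f x))) :
    L.meanDisp F (Γ x) = fun n : ℕ => birkhoffSum (fun x => max a (f x)) φ n x / n := by
  funext n
  obtain ⟨l, hl, hF⟩ := K.iterate_eq hba hφq hx hae (n := n) fun j _ _ => hfree j
  rw [K.meanDisp_eq hF, hl]

theorem stay_of_free (K : L.IsModel F Γ z b e f s t q) (hba : b ≤ a)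
    (hφq : ∀ i, ∀ x ∈ Icc (s i) (t i), φ x = q i) {x : ℝ} (hx : x ∈ Icc a e)
    (hae : a ≤ e) (hfree : x ∈ FoldSystem.free a (fun x => max a (f x))) :
    Γ x ∈ L.stay F (Γ '' Icc b e) := by
  refine ⟨mem_image_of_mem _ ⟨hba.trans hx.1, hx.2⟩, fun n hn => ?_⟩
  obtain ⟨l, -, hF⟩ := K.iterate_eq hba hφq hx hae (n := n) fun j _ _ => hfree j
  refine mem_addInt.mpr ⟨l, _, mem_image_of_mem _ ⟨hba.trans (hfree n).le, ?_⟩, hF.symm⟩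
  obtain ⟨n, rfl⟩ := Nat.exists_eq_add_of_le' hn
  rw [Function.iterate_succ_apply']
  exact max_le hae (K.maps _).2

/-- A point that stays never reaches the first fixed point or has the rotation number of it. -/
theorem free_or_hasRot (K : L.IsModel F Γ z b e f s t q) (hba : b ≤ a)
    (hFa : F (Γ a) = L.translate (q 0) (Γ a))
    (hmin : ∀ x ∈ Icc b e, Γ x ∈ L.stay F (Γ '' Icc b e) → a ≤ x) {x : ℝ} (hx : x ∈ Icc a e)
    (hst : Γ x ∈ L.stay F (Γ '' Icc b e)) :
    x ∈ FoldSystem.free a (fun x => max a (f x)) ∨ L.HasRot F (Γ x) (q 0) := by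
  by_cases hfree : ∀ n : ℕ, a < f^[n] x
  · left
    intro n
    have : (fun x => max a (f x))^[n] x = f^[n] x := by
      induction n with
      | zero => rfl
      | succ n ih =>
        rw [Function.iterate_succ_apply', ih, ← Function.iterate_succ_apply' f]
        exact max_eq_right (hfree (n + 1)).le
    rw [this]
    exact hfree n
  · right
    push Not at hfree
    obtain ⟨n, hn⟩ := hfree
    obtain ⟨h1, ⟨k, hk⟩, h3⟩ := K.orbit ⟨hba.trans hx.1, hx.2⟩ hst n
    rw [le_antisymm hn (hmin _ h1 h3)] at hk
    have hiter : ∀ j : ℕ, F^[n + j] (Γ x) = L.translate (k + j * q 0) (Γ a) := by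
      intro j
      induction j with
      | zero => simpa using hk
      | succ j ih =>
        rw [← add_assoc, Function.iterate_succ_apply', ih, map_translate K.degree, hFa,
          ← translate_add]
        congr 1
        push_cast; ring
    have hlim : Tendsto (fun N : ℕ => ((k : ℝ) - n * q 0) / N + q 0) atTop (𝓝 (0 + q 0)) :=
      (tendsto_const_div_atTop_nhds_zero_nat _).add_const _
    rw [zero_add] at hlim
    refine hlim.congr' ?_
    filter_upwards [eventually_ge_atTop (n + 1)] with N hN
    obtain ⟨j, rfl⟩ := Nat.exists_eq_add_of_le ((Nat.le_succ n).trans hN)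
    have hpos : ((n + j : ℕ) : ℝ) ≠ 0 := by
      have : n + j ≠ 0 := by omega
      exact_mod_cast this
    rw [K.meanDisp_eq (hiter j)]
    field_simp
    push_cast
    ring

theorem isPeriodicMod (K : L.IsModel F Γ z b e f s t q) (hba : b ≤ a)
    (hφq : ∀ i, ∀ x ∈ Icc (s i) (t i), φ x = q i) {x : ℝ} (hx : x ∈ Icc a e)
    (hae : a ≤ e) (hfree : x ∈ FoldSystem.free a (fun x => max a (f x))) {n : ℕ} (hn : 1 ≤ n)
    (hfix : (fun x => max a (f x))^[n] x = x) : L.IsPeriodicMod F (Γ x) := by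
  obtain ⟨l, -, hF⟩ := K.iterate_eq hba hφq hx hae (n := n) fun j _ _ => hfree j
  exact ⟨n, hn, l, by rw [hF, hfix]⟩

/-- A reached point other than `a` is reached along an orbit that avoids `a`, hence along a true
orbit of `F` modulo translations; `a` itself lies in the first interval. -/
theorem mem_orbitClosure (K : L.IsModel F Γ z b e f s t q) (ha : a ∈ Icc (s 0) (t 0))
    (hfa : f a = a) (hφ : Continuous φ) (hφq : ∀ i, ∀ x ∈ Icc (s i) (t i), φ x = q i) {p : ℝ}
    (hp : p ∈ closure (FoldSystem.reach a (t 0) (fun x => max a (f x)))) :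
    Γ p ∈ L.orbitClosure F (Γ '' Icc (s 0) (t 0)) := by
  have H := K.foldSystem ha hfa hφ hφq
  refine map_mem_closure K.continuous_param hp fun w hw => ?_
  by_cases hwa : w = a
  · rw [hwa]
    exact mem_iUnion.mpr ⟨0, mem_addInt.mpr ⟨0, Γ a, ⟨Γ a, mem_image_of_mem _ ha, rfl⟩, rfl⟩⟩
  obtain ⟨n, y, hy, rfl⟩ := mem_iUnion.mp hw
  have hye := H.Icc_subset hy
  obtain ⟨l, -, hF⟩ := K.iterate_eq (K.Icc_subset 0 ha).1 hφq hye (ha.2.trans (K.le_right 0))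
    (n := n) fun j _ hj => by
      refine lt_of_le_of_ne (H.iterate_mem hye j).1 fun h => hwa ?_
      obtain ⟨i, rfl⟩ := Nat.exists_eq_add_of_le hj
      exact H.iterate_add_eq_of_eq h.symm i
  refine mem_iUnion.mpr ⟨n, mem_addInt.mpr ⟨-l, F^[n] (Γ y),
    ⟨Γ y, mem_image_of_mem _ ⟨ha.1.trans hy.1, hy.2⟩, rfl⟩, ?_⟩⟩
  rw [hF, translate_neg_translate]

end Cut

theorem hasRot_of_periodic (K : L.IsModel F Γ z b e f s t q) {a : ℝ} (ha : a ∈ Icc (s 0) (t 0))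
    (hfa : f a = a) {φ : ℝ → ℝ} (hφ : Continuous φ) (hφq : ∀ i, ∀ x ∈ Icc (s i) (t i), φ x = q i)
    {p α : ℝ} (hp : p ∈ Icc a e) (hfree : p ∈ FoldSystem.free a (fun x => max a (f x))) {n : ℕ}
    (hn : 1 ≤ n) (hfix : (fun x => max a (f x))^[n] p = p)
    (hS : birkhoffSum (fun x => max a (f x)) φ n p = n * α) : L.HasRot F (Γ p) α := by
  rw [HasRot, K.meanDisp_eq_of_free (K.Icc_subset 0 ha).1 hφq hp (ha.2.trans (K.le_right 0)) hfree]
  exact (K.foldSystem ha hfa hφ hφq).tendsto_of_periodic hn hp hfix hS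

theorem rotation_interval (K : L.IsModel F Γ z b e f s t q)
    (hne : ∃ x ∈ Icc (s 0) (t 0), Γ x ∈ L.stay F (Γ '' Icc b e)) {S₀ : Set T}
    (hS₀ : S₀ = Γ '' Icc (s 0) (t 0) ∩ L.stay F (Γ '' Icc b e)) :
    ∃ c d : ℝ, c ≤ d ∧
      (L.Rot F S₀ = Icc c d ∧ L.RotSup F S₀ = Icc c d ∧ L.RotInf F S₀ = Icc c d) ∧
      (q 0 : ℝ) ∈ Icc c d ∧
      (∃ a ∈ Icc (s 0) (t 0), Γ a ∈ L.stay F (Γ '' Icc b e) ∧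
        F (Γ a) = L.translate (q 0) (Γ a) ∧
        ∀ x ∈ Icc b e, Γ x ∈ L.stay F (Γ '' Icc b e) → a ≤ x) ∧
      (∀ r : ℚ, (r : ℝ) ∈ interior (Icc c d) → ∃ x ∈ S₀, L.IsPeriodicMod F x ∧ L.HasRot F x r) ∧
      (∀ r : ℚ, (r : ℝ) ∈ frontier (Icc c d) →
        ∃ x ∈ L.orbitClosure F (Γ '' Icc (s 0) (t 0)) ∩ L.stay F (Γ '' Icc b e),
          L.IsPeriodicMod F x ∧ L.HasRot F x r) := by
  obtain ⟨a, ha, hfa, hFa, hmin⟩ := K.exists_first_fixed hne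
  obtain ⟨φ, hφ, hφq⟩ := exists_continuous_eq_on_Icc K.lt q
  have H := K.foldSystem ha hfa hφ hφq
  have hba := (K.Icc_subset 0 ha).1
  have hae := (K.Icc_subset 0 ha).2
  have hiter : ∀ n : ℕ, F^[n] (Γ a) = L.translate (n * q 0) (Γ a) := by
    intro n
    induction n with
    | zero => simp [translate_zero]
    | succ n ih =>
      rw [Function.iterate_succ_apply', ih, map_translate K.degree, hFa, ← translate_add]
      congr 1
      push_cast; ring
  have hastay : Γ a ∈ L.stay F (Γ '' Icc b e) :=
    ⟨mem_image_of_mem _ ⟨hba, hae⟩, fun n _ =>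
      mem_addInt.mpr ⟨_, _, mem_image_of_mem _ ⟨hba, hae⟩, (hiter n).symm⟩⟩
  have haS : Γ a ∈ S₀ := hS₀ ▸ ⟨mem_image_of_mem _ ha, hastay⟩
  have haper : L.IsPeriodicMod F (Γ a) := ⟨1, le_rfl, q 0, hFa⟩
  have harot : L.HasRot F (Γ a) (q 0) := by
    refine tendsto_const_nhds.congr' ?_
    filter_upwards [eventually_ge_atTop 1] with n hn
    have : (n : ℝ) ≠ 0 := by positivity
    rw [K.meanDisp_eq (hiter n)]
    push_cast
    field_simp
  have haorb : Γ a ∈ L.orbitClosure F (Γ '' Icc (s 0) (t 0)) :=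
    K.mem_orbitClosure ha hfa hφ hφq (subset_closure (FoldSystem.subset_reach H.left_mem))
  obtain ⟨d, hkd, hup, htend, hper, hbdry⟩ := H.exists_upper_end
  -- The system with displacement `-φ` has the same map and the same reached points; its upper end
  -- `c'` gives the lower end `-c'`.
  obtain ⟨c', hkc', hup', htend', hper', hbdry'⟩ := H.neg.exists_upper_end
  have hneg : ∀ (n : ℕ) x, birkhoffSum (fun x => max a (f x)) (fun x => -φ x) n x
      = -birkhoffSum (fun x => max a (f x)) φ n x := fun n x => by
    simp [birkhoffSum]
  simp only [hneg, neg_div] at hup' htend' hper' hbdry'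
  push_cast at hkc' htend' hper' hbdry'
  have hq : (q 0 : ℝ) ∈ Icc (-c') d := ⟨by linarith, hkd⟩
  have hcd : -c' ≤ d := hq.1.trans hq.2
  have hfreeS : ∀ x ∈ Icc a (t 0) ∩ FoldSystem.free a (fun x => max a (f x)), Γ x ∈ S₀ :=
    fun x hx => hS₀ ▸ ⟨mem_image_of_mem _ ⟨ha.1.trans hx.1.1, hx.1.2⟩,
      K.stay_of_free hba hφq (H.Icc_subset hx.1) hae hx.2⟩
  have hfreerot : ∀ x ∈ Icc a (t 0) ∩ FoldSystem.free a (fun x => max a (f x)),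
      L.meanDisp F (Γ x) = fun n : ℕ => birkhoffSum (fun x => max a (f x)) φ n x / n :=
    fun x hx => K.meanDisp_eq_of_free hba hφq (H.Icc_subset hx.1) hae hx.2
  have hbounds : ∀ w ∈ S₀, (∀ ε > 0, ∀ᶠ n in atTop, L.meanDisp F w n ≤ d + ε) ∧
      (∀ ε > 0, ∀ᶠ n in atTop, -c' - ε ≤ L.meanDisp F w n) := by
    intro w hw
    rw [hS₀] at hw
    obtain ⟨⟨x, hx, rfl⟩, hst⟩ := hw
    have hxa : x ∈ Icc a (t 0) := ⟨hmin x (K.Icc_subset 0 hx) hst, hx.2⟩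
    rcases K.free_or_hasRot hba hFa hmin (H.Icc_subset hxa) hst with hfree | hrot
    · rw [hfreerot x ⟨hxa, hfree⟩]
      refine ⟨hup x ⟨hxa, hfree⟩, fun ε hε => ?_⟩
      filter_upwards [hup' x ⟨hxa, hfree⟩ ε hε] with n hn
      linarith
    · refine ⟨fun ε hε => ?_, fun ε hε => ?_⟩
      · exact hrot.eventually_le_const (by linarith [hq.2])
      · exact hrot.eventually_const_le (by linarith [hq.1])
  have hmem : ∀ w ∈ S₀, L.upperRot F w ∈ Icc (-c') d ∧ L.lowerRot F w ∈ Icc (-c') d :=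
    fun w hw => limsup_liminf_mem_Icc (hbounds w hw).1 (hbounds w hw).2
  have hreal : ∀ α ∈ Icc (-c') d, ∃ w ∈ S₀, L.HasRot F w α := by
    intro α hα
    rcases lt_trichotomy (q 0 : ℝ) α with h | rfl | h
    · obtain ⟨y, hy, hlim⟩ := htend α h hα.2
      exact ⟨Γ y, hfreeS y hy, by rw [HasRot, hfreerot y hy]; exact hlim⟩
    · exact ⟨Γ a, haS, harot⟩
    · obtain ⟨y, hy, hlim⟩ := htend' (-α) (by linarith) (by linarith [hα.1])
      refine ⟨Γ y, hfreeS y hy, ?_⟩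
      rw [HasRot, hfreerot y hy]
      simpa using hlim.neg
  have hperiodic : ∀ p ∈ Icc a e ∩ FoldSystem.free a (fun x => max a (f x)), ∀ n : ℕ, ∀ α : ℝ,
      1 ≤ n → (fun x => max a (f x))^[n] p = p →
      birkhoffSum (fun x => max a (f x)) φ n p = n * α →
      L.IsPeriodicMod F (Γ p) ∧ L.HasRot F (Γ p) α := fun p hp n α hn hfix hS =>
    ⟨K.isPeriodicMod hba hφq hp.1 hae hp.2 hn hfix,
      K.hasRot_of_periodic ha hfa hφ hφq hp.1 hp.2 hn hfix hS⟩
  refine ⟨-c', d, hcd, ⟨?_, ?_, ?_⟩, hq, ⟨a, ha, hastay, hFa, hmin⟩, ?_, ?_⟩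
  · refine Subset.antisymm ?_ hreal
    rintro ρ ⟨w, hw, hρ⟩
    have := (hmem w hw).1
    rwa [upperRot, hρ.limsup_eq] at this
  · refine Subset.antisymm ?_ fun α hα => ?_
    · rintro _ ⟨w, hw, rfl⟩
      exact (hmem w hw).1
    · obtain ⟨w, hw, hρ⟩ := hreal α hα
      exact ⟨w, hw, hρ.limsup_eq⟩
  · refine Subset.antisymm ?_ fun α hα => ?_
    · rintro _ ⟨w, hw, rfl⟩
      exact (hmem w hw).2
    · obtain ⟨w, hw, hρ⟩ := hreal α hα
      exact ⟨w, hw, hρ.liminf_eq⟩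
  · intro r hr
    rw [interior_Icc] at hr
    rcases lt_trichotomy (q 0 : ℝ) r with h | h | h
    · obtain ⟨p, hp, n, hn, hfix, hS⟩ := hper r h hr.2
      exact ⟨Γ p, hfreeS p hp, hperiodic p ⟨H.Icc_subset hp.1, hp.2⟩ n r hn hfix hS⟩
    · exact ⟨Γ a, haS, haper, h ▸ harot⟩
    · obtain ⟨p, hp, n, hn, hfix, hS⟩ := hper' (-r) (by push_cast; linarith)
        (by push_cast; linarith [hr.1])
      refine ⟨Γ p, hfreeS p hp, hperiodic p ⟨H.Icc_subset hp.1, hp.2⟩ n r hn hfix ?_⟩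
      push_cast at hS
      linarith
  · intro r hr
    rw [frontier_Icc hcd] at hr
    rcases lt_trichotomy (q 0 : ℝ) r with h | h | h
    · have hrd : (r : ℝ) = d := by
        rcases hr with hr | hr
        · linarith [hq.1]
        · exact hr
      obtain ⟨p, hp, n, hn, hfix, hS⟩ := hbdry r h hrd
      have hpe := H.closure_reach_subset hp.1
      exact ⟨Γ p, ⟨K.mem_orbitClosure ha hfa hφ hφq hp.1, K.stay_of_free hba hφq hpe hae hp.2⟩,
        hperiodic p ⟨hpe, hp.2⟩ n r hn hfix hS⟩
    · exact ⟨Γ a, ⟨haorb, hastay⟩, haper, h ▸ harot⟩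
    · have hrc : (r : ℝ) = -c' := by
        rcases hr with hr | hr
        · exact hr
        · have : (r : ℝ) = d := hr
          linarith [hq.2]
      obtain ⟨p, hp, n, hn, hfix, hS⟩ := hbdry' (-r) (by push_cast; linarith)
        (by push_cast; linarith)
      have hpe := H.closure_reach_subset hp.1
      refine ⟨Γ p, ⟨K.mem_orbitClosure ha hfa hφ hφq hp.1, K.stay_of_free hba hφq hpe hae hp.2⟩,
        hperiodic p ⟨hpe, hp.2⟩ n r hn hfix ?_⟩
      push_cast at hS
      linarith

end IsModel

end LineShift

/-! ### Reduction of the proposition to the interval model -/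

theorem image_projIcc_Icc {T : Type*} (γ : unitInterval → T) (u v : unitInterval) :
    (fun x : ℝ => γ (projIcc 0 1 zero_le_one x)) '' Icc (u : ℝ) v = γ '' Icc u v := by
  refine Subset.antisymm ?_ ?_
  · rintro _ ⟨x, hx, rfl⟩
    have hx1 : x ∈ Icc (0 : ℝ) 1 := ⟨u.2.1.trans hx.1, hx.2.trans v.2.2⟩
    simp only [projIcc_of_mem zero_le_one hx1]
    exact mem_image_of_mem _ ⟨hx.1, hx.2⟩
  · rintro _ ⟨x, hx, rfl⟩
    exact ⟨x, ⟨hx.1, hx.2⟩, by simp only [projIcc_val]⟩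

theorem mainTheorem2 {T : Type*} [TopologicalSpace T] [T2Space T] [ConnectedSpace T]
    (L : LineShift T) (hL : L.IsLiftedGraph)
    (F : T → T) (hF : L.IsSigmaLike F)
    -- the order of `X_F`
    (γ : unitInterval → T) (hγ : L.IsBranch F γ)
    -- the invariant set `T'` and the interval `Y`
    (T' : Set T) (hconn : IsConnected T') (hTR : L.TR F ⊆ T')
    (hshift : L.τ '' T' = T') (hinv : F '' T' ⊆ T')
    (Y : Set T) (hY : Y = L.coreg T')
    -- the intervals `Y_1, ..., Y_M` (`M ≥ 1`), numbered from `0`, and their jumps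
    (M : ℕ) (s t : Fin (M + 1) → unitInterval) (hst : ∀ i, s i ≤ t i)
    (Z : Fin (M + 1) → Set T) (hZ : ∀ i, Z i = γ '' Icc (s i) (t i)) (hZY : ∀ i, Z i ⊆ Y)
    (q : Fin (M + 1) → ℤ)
    (ha : ∀ i j, i < j → t i < s j)
    (hb : ∀ i, F '' Z i ⊆ L.translate (q i) '' Y ∪ T')
    (hc : ∃ u, IsLeast (γ ⁻¹' Y) u ∧ F (γ (s 0)) = L.translate (q 0) (γ u))
    (hd : F '' (Y \ ⋃ i, Z i) ∩ L.addInt Y = ∅)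
    (hne : (Z 0 ∩ L.stay F Y).Nonempty) :
    ∃ c d : ℝ, c ≤ d ∧
      (L.Rot F (Z 0 ∩ L.stay F Y) = Icc c d ∧
        L.RotSup F (Z 0 ∩ L.stay F Y) = Icc c d ∧
        L.RotInf F (Z 0 ∩ L.stay F Y) = Icc c d) ∧
      (q 0 : ℝ) ∈ Icc c d ∧
      (∃ α ∈ Icc (s 0) (t 0), γ α ∈ L.stay F Y ∧
        F (γ α) = L.translate (q 0) (γ α) ∧ γ '' Ico (s 0) α ∩ L.stay F Y = ∅) ∧
      (∀ r : ℚ, (r : ℝ) ∈ interior (Icc c d) →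
        ∃ x ∈ Z 0 ∩ L.stay F Y, L.IsPeriodicMod F x ∧ L.HasRot F x r) ∧
      (∀ r : ℚ, (r : ℝ) ∈ frontier (Icc c d) →
        ∃ x ∈ L.orbitClosure F (Z 0) ∩ L.stay F Y, L.IsPeriodicMod F x ∧ L.HasRot F x r) := by
  have hdeg := hF.1
  obtain ⟨b, hbY, hF0⟩ := hc
  subst hY
  have hYb : L.coreg T' = γ '' Ici b := hγ.coreg_eq hL hdeg hconn hTR hbY
  -- Extending the branch by constants makes the model map continuous on all of `ℝ`.
  set Γ : ℝ → T := fun x => γ (projIcc 0 1 zero_le_one x) with hΓ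
  have hΓγ : ∀ u : unitInterval, Γ u = γ u := fun u => by simp only [hΓ, projIcc_val]
  have hΓim : ∀ u v : unitInterval, Γ '' Icc (u : ℝ) v = γ '' Icc u v := image_projIcc_Icc γ
  have hYΓ : L.coreg T' = Γ '' Icc (b : ℝ) 1 := by
    have : Ici b = Icc b 1 := by
      ext u
      exact ⟨fun h => ⟨h, u.2.2⟩, fun h => h.1⟩
    rw [hYb, this, ← hΓim]
    rfl
  have hZΓ : ∀ i, Z i = Γ '' Icc (s i : ℝ) (t i) := fun i => by rw [hZ, hΓim]
  have hbs : ∀ i, b ≤ s i := fun i => by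
    have : γ (s i) ∈ L.coreg T' := hZY i (hZ i ▸ mem_image_of_mem _ ⟨le_rfl, hst i⟩)
    exact hbY.2 this
  have hmap : ∀ x, F (Γ x) ∈ L.addInt (L.coreg T') →
      ∃ k, F (Γ x) = L.translate k (Γ (LineShift.IsBranch.proj L γ b (F (Γ x)))) := by
    intro x hx
    rw [hYb] at hx
    obtain ⟨k, _, ⟨v, hv, rfl⟩, hk⟩ := LineShift.mem_addInt.mp hx
    refine ⟨k, ?_⟩
    rw [← hk, hγ.proj_translate hL hv, hΓγ]
  have hmem : ∀ x ∈ Icc (b : ℝ) 1, F (Γ x) ∈ L.addInt (L.coreg T') →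
      ∃ i, x ∈ Icc (s i : ℝ) (t i) := by
    intro x hx hFx
    by_contra! hcon
    have hx1 : x ∈ Icc (0 : ℝ) 1 := ⟨b.2.1.trans hx.1, hx.2⟩
    have : F (Γ x) ∈ F '' (L.coreg T' \ ⋃ i, Z i) ∩ L.addInt (L.coreg T') := by
      refine ⟨mem_image_of_mem _ ⟨hYΓ ▸ mem_image_of_mem _ hx, fun h => ?_⟩, hFx⟩
      obtain ⟨i, hi⟩ := mem_iUnion.mp h
      rw [hZ] at hi
      obtain ⟨v, hv, hvx⟩ := hi
      have := hγ.injective hvx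
      rw [projIcc_of_mem zero_le_one hx1] at this
      subst this
      exact hcon i ⟨hv.1, hv.2⟩
    rw [hd] at this
    exact this
  have K : L.IsModel F Γ (L.retr (γ 1)) b 1
      (fun x => (LineShift.IsBranch.proj L γ b (F (Γ x)) : ℝ)) (fun i => (s i : ℝ)) (fun i => (t i : ℝ)) q :=
    { degree := hdeg
      continuous_param := hγ.continuous.comp continuous_projIcc
      continuous_map := continuous_subtype_val.comp ((hγ.continuous_proj hL hdeg b).comp
        (hdeg.1.comp (hγ.continuous.comp continuous_projIcc)))
      retr_eq := fun k x => hγ.retr_translate_eq hL k _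
      maps := fun x => ⟨LineShift.IsBranch.le_proj b _, (LineShift.IsBranch.proj L γ b (F (Γ x))).2.2⟩
      le_left := hbs
      le := hst
      le_right := fun i => (t i).2.2
      lt := ha
      map_eq := fun x _ hFx => hmap x (hYΓ ▸ hFx)
      exists_mem := fun x hx hFx => hmem x hx (hYΓ ▸ hFx)
      map_eq_of_lt := by
        intro x hx hlt
        obtain ⟨k, hk⟩ := LineShift.IsBranch.exists_of_lt_proj hlt
        have hpY : γ (LineShift.IsBranch.proj L γ b (F (Γ x))) ∈ L.coreg T' :=
          hYb ▸ mem_image_of_mem _ (LineShift.IsBranch.le_proj b _)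
        obtain ⟨i, hi⟩ := hmem x hx (LineShift.mem_addInt.mpr ⟨k, _, hpY, hk.symm⟩)
        refine ⟨i, hi, ?_⟩
        -- The image is a translate of a branch point beyond `b`, which is not in `T'`. So (b)
        -- places it in the translate of `Y` by `q i`, and distinct translates of the branch are
        -- disjoint.
        rcases hb i (mem_image_of_mem F (hZΓ i ▸ mem_image_of_mem Γ hi)) with h | h
        · rw [hYb] at h
          obtain ⟨_, ⟨v, -, rfl⟩, hv⟩ := h
          obtain ⟨rfl, -⟩ := hγ.translate_inj hL (hv.trans hk)
          rw [hΓγ]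
          exact hk
        · refine absurd ?_ (hγ.notMem_of_isLeast_lt hL hdeg hconn hTR hbY hlt)
          have := LineShift.translate_mem_of_image_eq hshift (-k) h
          rwa [hk, LineShift.translate_neg_translate] at this
      map_zero := by
        simp only [hΓγ, hF0, hγ.proj_translate hL le_rfl]
      base := fun h => by
        have : s 0 = b := Subtype.ext h
        rw [hΓγ, ← hF0, this] }
  rw [hYΓ] at hne ⊢
  have hS₀ : Z 0 ∩ L.stay F (Γ '' Icc (b : ℝ) 1)
      = Γ '' Icc (s 0 : ℝ) (t 0) ∩ L.stay F (Γ '' Icc (b : ℝ) 1) := by rw [hZΓ]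
  have hne' : ∃ x ∈ Icc (s 0 : ℝ) (t 0), Γ x ∈ L.stay F (Γ '' Icc (b : ℝ) 1) := by
    rw [hS₀] at hne
    obtain ⟨_, ⟨x, hx, rfl⟩, hst⟩ := hne
    exact ⟨x, hx, hst⟩
  obtain ⟨c, d, h1, h2, h3, ⟨a, haI, hast, hFa, hmin⟩, h5, h6⟩ := K.rotation_interval hne' hS₀
  refine ⟨c, d, h1, h2, h3, ?_, h5, by rw [hZΓ]; exact h6⟩
  have ha1 : a ∈ Icc (0 : ℝ) 1 := ⟨(s 0).2.1.trans haI.1, haI.2.trans (t 0).2.2⟩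
  refine ⟨⟨a, ha1⟩, ⟨haI.1, haI.2⟩, by rwa [← hΓγ], by rwa [← hΓγ], ?_⟩
  refine eq_empty_of_forall_notMem ?_
  rintro _ ⟨⟨u, hu, rfl⟩, hust⟩
  have := hmin u ⟨(hbs 0).trans hu.1, u.2.2⟩ (by rwa [hΓγ])
  exact not_lt.mpr this hu.2
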